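/- **Theorem B.** Let $k$ be an algebraically closed field. Let $\mathbb{G}$ be the smallest class of groups (closed under isomorphism) that contains all cyclic groups, finite or infinite, and such that $G\amalg H$ (free product) and $G\times H$ belong to $\mathbb{G}$ whenever $G$ and $H$ do. Let $G_1,\dots,G_n\in\mathbb{G}$. Then there exist a basic, connected, finite-dimensional $k$-algebra $A$ that is triangular, i.e. whose quiver $Q_A$ (finite and connected) has no oriented cycles, and presentations $\nu_i\colon kQ_A\to A$ with kernels $I_i$, so that $A\simeq kQ_A/I_i$, for $i\in\{1,\dots,n\}$, such that $\pi_1(Q_A,I_i)\simeq G_i$ for every $i$. Here $kQ$ denotes the path algebra of a finite quiver $Q$, and $F$ is its two-sided ideal generated by the arrows. A two-sided ideal $I$ of $kQ$ is *admissible* if $F^m\subseteq I\subseteq F^2$ for some $m\ge 2$. A *presentation* of $A$ is a surjective morphism of $k$-algebras $kQ_A\to A$ whose kernel is admissible. A *minimal relation* of $I$ is an element $\sum_{i=1}^m\lambda_iw_i\in I$ with $m\ge2$, $\lambda_i\in k\setminus\{0\}$ and $w_1,\dots,w_m$ distinct paths with a common source and a common target, such that $\sum_{i\in J}\lambda_iw_i\notin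 I$ for every nonempty proper subset $J\subset\{1,\dots,m\}$. A *walk* is a composable sequence of arrows and formal inverses of arrows. *Homotopy* is the smallest equivalence relation $\sim$ on walks, compatible with composition, such that $\alpha\alpha^{-1}\sim e_x$ and $\alpha^{-1}\alpha\sim e_y$ for every arrow $\alpha\colon x\to y$, and such that $w_i\sim w_j$ for any two paths $w_i,w_j$ that occur in a common minimal relation of $I$. The fundamental group $\pi_1(Q,I)$ is the group of homotopy classes of closed walks at a vertex $x$; for connected $Q$ it does not depend on $x$ up to isomorphism. -/

import Mathlib

universe u v w

noncomputable section

/-! ### The path algebra of a quiver -/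

/-- The underlying space of the path algebra `kQ`: the `k`-vector space whose basis is the set of
all paths of the quiver, including the stationary paths. -/
def PathAlgebra (k : Type u) (V : Type v) [Field k] [Quiver.{w} V] : Type (max u v w) :=
  (Σ a b : V, Quiver.Path a b) →₀ k

namespace PathAlgebra

variable (k : Type u) {V : Type v} [Field k] [Quiver.{w} V]

instance : AddCommGroup (PathAlgebra k V) :=
  inferInstanceAs (AddCommGroup ((Σ a b : V, Quiver.Path a b) →₀ k))

instance : Module k (PathAlgebra k V) :=
  inferInstanceAs (Module k ((Σ a b : V, Quiver.Path a b) →₀ k))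

variable (V) in
/-- The basis of `kQ` formed by the paths. -/
def basis : Module.Basis (Σ a b : V, Quiver.Path a b) k (PathAlgebra k V) :=
  Module.Basis.ofRepr (LinearEquiv.refl k ((Σ a b : V, Quiver.Path a b) →₀ k))

/-- The basis element of `kQ` given by a path. -/
def ofPath {a b : V} (p : Quiver.Path a b) : PathAlgebra k V := basis k V ⟨a, b, p⟩

open Classical in
/-- The product of two paths in `kQ`: their composition if the first one ends where the second one
starts, and `0` otherwise. -/
def pathMul (p q : Σ a b : V, Quiver.Path a b) : PathAlgebra k V :=
  if h : q.1 = p.2.1 then ofPath k (p.2.2.comp (q.2.2.cast h rfl)) else 0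

/-- The multiplication of `kQ` as a bilinear map. -/
def mulMap : PathAlgebra k V →ₗ[k] PathAlgebra k V →ₗ[k] PathAlgebra k V :=
  (basis k V).constr k fun p => (basis k V).constr k fun q => pathMul k p q

instance : Mul (PathAlgebra k V) := ⟨fun f g => mulMap k f g⟩

variable {k}

theorem mul_def (f g : PathAlgebra k V) : f * g = mulMap k f g := rfl

theorem mulMap_ofPath {a b c d : V} (p : Quiver.Path a b) (q : Quiver.Path c d) :
    mulMap k (ofPath k p) (ofPath k q) = pathMul k ⟨a, b, p⟩ ⟨c, d, q⟩ := by
  simp only [mulMap, ofPath, Module.Basis.constr_basis]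

theorem ofPath_mul_ofPath {a b c : V} (p : Quiver.Path a b) (q : Quiver.Path b c) :
    ofPath k p * ofPath k q = ofPath k (p.comp q) := by
  rw [mul_def, mulMap_ofPath, pathMul, dif_pos rfl]
  rfl

theorem ofPath_mul_ofPath_of_ne {a b c d : V} (p : Quiver.Path a b) (q : Quiver.Path c d)
    (h : c ≠ b) : ofPath k p * ofPath k q = 0 := by
  rw [mul_def, mulMap_ofPath, pathMul, dif_neg h]

/-- Linear maps out of `kQ` that agree on all paths are equal. -/
theorem hom_ext {M : Type*} [AddCommMonoid M] [Module k M] {f g : PathAlgebra k V →ₗ[k] M}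
    (h : ∀ (a b : V) (p : Quiver.Path a b), f (ofPath k p) = g (ofPath k p)) : f = g :=
  (basis k V).ext fun ⟨a, b, p⟩ => h a b p

protected theorem mul_assoc (f g h : PathAlgebra k V) : f * g * h = f * (g * h) := by
  have e : (mulMap k (V := V)).compr₂ (mulMap k) =
      ((LinearMap.llcomp k (PathAlgebra k V) (PathAlgebra k V →ₗ[k] PathAlgebra k V)
        (PathAlgebra k V →ₗ[k] PathAlgebra k V)).flip (mulMap k)).comp
        ((LinearMap.llcomp k (PathAlgebra k V) (PathAlgebra k V)
          (PathAlgebra k V)).comp (mulMap k)) := by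
    refine hom_ext fun a b p => hom_ext fun c d q => hom_ext fun x y r => ?_
    change ofPath k p * ofPath k q * ofPath k r = ofPath k p * (ofPath k q * ofPath k r)
    by_cases h₁ : c = b
    · subst h₁
      by_cases h₂ : x = d
      · subst h₂
        simp only [ofPath_mul_ofPath, Quiver.Path.comp_assoc]
      · rw [ofPath_mul_ofPath, ofPath_mul_ofPath_of_ne _ _ h₂, ofPath_mul_ofPath_of_ne _ _ h₂,
          mul_def, map_zero]
    · rw [ofPath_mul_ofPath_of_ne _ _ h₁]
      by_cases h₂ : x = d
      · subst h₂
        rw [ofPath_mul_ofPath, ofPath_mul_ofPath_of_ne _ _ h₁, mul_def, map_zero,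
          LinearMap.zero_apply]
      · rw [ofPath_mul_ofPath_of_ne _ _ h₂]
        simp [mul_def]
  exact LinearMap.congr_fun (LinearMap.congr_fun (LinearMap.congr_fun e f) g) h

variable [Fintype V]

/-- The unit of `kQ` is the sum of all stationary paths. -/
instance : One (PathAlgebra k V) := ⟨∑ x : V, ofPath k (Quiver.Path.nil : Quiver.Path x x)⟩

theorem one_def :
    (1 : PathAlgebra k V) = ∑ x : V, ofPath k (Quiver.Path.nil : Quiver.Path x x) := rfl

protected theorem one_mul (f : PathAlgebra k V) : 1 * f = f := by
  have e : mulMap k (V := V) 1 = LinearMap.id := by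
    refine hom_ext fun a b p => ?_
    rw [one_def, map_sum, LinearMap.sum_apply, Finset.sum_eq_single a]
    · exact (ofPath_mul_ofPath _ _).trans (by rw [Quiver.Path.nil_comp]; rfl)
    · intro x _ hx
      exact ofPath_mul_ofPath_of_ne _ _ (Ne.symm hx)
    · simp
  exact LinearMap.congr_fun e f

protected theorem mul_one (f : PathAlgebra k V) : f * 1 = f := by
  have e : (mulMap k (V := V)).flip 1 = LinearMap.id := by
    refine hom_ext fun a b p => ?_
    rw [LinearMap.flip_apply, one_def, map_sum, Finset.sum_eq_single b]
    · exact (ofPath_mul_ofPath _ _).trans (by rw [Quiver.Path.comp_nil]; rfl)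
    · intro x _ hx
      exact ofPath_mul_ofPath_of_ne _ _ hx
    · simp
  exact LinearMap.congr_fun e f

instance : Ring (PathAlgebra k V) :=
  { (inferInstance : AddCommGroup (PathAlgebra k V)) with
    mul := (· * ·)
    one := 1
    mul_assoc := PathAlgebra.mul_assoc
    one_mul := PathAlgebra.one_mul
    mul_one := PathAlgebra.mul_one
    left_distrib := fun f g h => map_add (mulMap k f) g h
    right_distrib := fun f g h => LinearMap.map_add₂ (mulMap k) f g h
    zero_mul := fun f => LinearMap.map_zero₂ (mulMap k) f
    mul_zero := fun f => map_zero (mulMap k f) }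

instance : Algebra k (PathAlgebra k V) :=
  Algebra.ofModule (fun r f g => LinearMap.map_smul₂ (mulMap k) r f g)
    (fun r f g => map_smul (mulMap k f) r g)

variable (k V)

/-- The two-sided ideal `F` of `kQ` generated by the arrows. -/
def arrowIdeal : Ideal (PathAlgebra k V) :=
  (TwoSidedIdeal.span
    {f : PathAlgebra k V | ∃ (a b : V) (α : a ⟶ b), f = ofPath k α.toPath}).asIdeal

variable {k V}

/-- A two-sided ideal `I` of `kQ` is admissible if `F ^ m ⊆ I ⊆ F ^ 2` for some `m ≥ 2`. -/
structure IsAdmissible (I : Ideal (PathAlgebra k V)) : Prop where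
  isTwoSided : I.IsTwoSided
  exists_pow_le : ∃ m : ℕ, 2 ≤ m ∧ arrowIdeal k V ^ m ≤ I
  le_sq : I ≤ arrowIdeal k V ^ 2

/-- The relation `∑ λ_w w`, where `c w = λ_w` is nonzero exactly for the paths `w` (from `x` to `y`)
in the finite set `c.support`, is a minimal relation of `I`: it lies in `I`, involves at least two
paths, and none of its proper nonempty partial sums lies in `I`. -/
structure IsMinimalRelation (I : Ideal (PathAlgebra k V)) {x y : V}
    (c : Quiver.Path x y →₀ k) : Prop where
  two_le_card : 2 ≤ c.support.card
  mem : ∑ w ∈ c.support, c w • ofPath k w ∈ I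
  notMem : ∀ J : Finset (Quiver.Path x y), J ⊂ c.support → J.Nonempty →
    ∑ w ∈ J, c w • ofPath k w ∉ I

end PathAlgebra

/-! ### The fundamental group of a bound quiver -/

/-- A walk from `x` to `y`: a composable sequence of arrows and formal inverses of arrows. -/
abbrev QuiverWalk {V : Type v} [Quiver.{w} V] (x y : Quiver.Symmetrify V) : Type (max v w) :=
  Quiver.Path x y

/-- A vertex viewed as a vertex of the quiver with formal inverses of arrows added. -/
abbrev Quiver.symVertex {V : Type v} [Quiver.{w} V] (x : V) : Quiver.Symmetrify V :=
  (Quiver.Symmetrify.of (V := V)).obj x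

/-- A path viewed as a walk. -/
def Quiver.Path.toWalk {V : Type v} [Quiver.{w} V] {x y : V} (p : Quiver.Path x y) :
    QuiverWalk (Quiver.symVertex x) (Quiver.symVertex y) :=
  (Quiver.Symmetrify.of (V := V)).mapPath p

open PathAlgebra in
/-- The homotopy relation on walks of `(Q, I)`: the smallest equivalence relation with
`α α⁻¹ ∼ e_x` and `α⁻¹ α ∼ e_y` for each arrow `α : x ⟶ y`, which identifies all paths that occur in
a common minimal relation, and which is compatible with composition. -/
inductive WalkHomotopic {k : Type u} {V : Type v} [Field k] [Quiver.{w} V] [Fintype V]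
    (I : Ideal (PathAlgebra k V)) :
    ∀ {x y : Quiver.Symmetrify V}, QuiverWalk x y → QuiverWalk x y → Prop
  | refl {x y : Quiver.Symmetrify V} (p : QuiverWalk x y) : WalkHomotopic I p p
  | symm {x y : Quiver.Symmetrify V} {p q : QuiverWalk x y} :
      WalkHomotopic I p q → WalkHomotopic I q p
  | trans {x y : Quiver.Symmetrify V} {p q r : QuiverWalk x y} :
      WalkHomotopic I p q → WalkHomotopic I q r → WalkHomotopic I p r
  | arrow_inv {x y : V} (α : x ⟶ y) :
      WalkHomotopic I (x := Quiver.symVertex x) (y := Quiver.symVertex x)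
        ((Quiver.Path.nil.cons α.toPos).cons α.toNeg) Quiver.Path.nil
  | inv_arrow {x y : V} (α : x ⟶ y) :
      WalkHomotopic I (x := Quiver.symVertex y) (y := Quiver.symVertex y)
        ((Quiver.Path.nil.cons α.toNeg).cons α.toPos) Quiver.Path.nil
  | minimal {x y : V} (c : Quiver.Path x y →₀ k) (hc : IsMinimalRelation I c)
      (p q : Quiver.Path x y) (hp : p ∈ c.support) (hq : q ∈ c.support) :
      WalkHomotopic I p.toWalk q.toWalk
  | comp {x' x y y' : Quiver.Symmetrify V} (s : QuiverWalk x' x) {p q : QuiverWalk x y}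
      (t : QuiverWalk y y') :
      WalkHomotopic I p q → WalkHomotopic I ((s.comp p).comp t) ((s.comp q).comp t)

namespace WalkHomotopic

variable {k : Type u} {V : Type v} [Field k] [Quiver.{w} V] [Fintype V]
  {I : Ideal (PathAlgebra k V)}

theorem comp_left {x y z : Quiver.Symmetrify V} (s : QuiverWalk x y) {p q : QuiverWalk y z}
    (h : WalkHomotopic I p q) : WalkHomotopic I (s.comp p) (s.comp q) :=
  WalkHomotopic.comp s Quiver.Path.nil h

theorem comp_right {x y z : Quiver.Symmetrify V} {p q : QuiverWalk x y} (h : WalkHomotopic I p q)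
    (t : QuiverWalk y z) : WalkHomotopic I (p.comp t) (q.comp t) := by
  simpa only [Quiver.Path.nil_comp] using WalkHomotopic.comp Quiver.Path.nil t h

theorem comp_congr {x y z : Quiver.Symmetrify V} {p p' : QuiverWalk x y} {q q' : QuiverWalk y z}
    (h : WalkHomotopic I p p') (h' : WalkHomotopic I q q') :
    WalkHomotopic I (p.comp q) (p'.comp q') :=
  (h.comp_right q).trans (h'.comp_left p')

theorem comp_reverse {x y : Quiver.Symmetrify V} (p : QuiverWalk x y) :
    WalkHomotopic I (p.comp p.reverse) Quiver.Path.nil := by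
  induction p with
  | nil => exact WalkHomotopic.refl _
  | @cons b c p e ih =>
    have h : WalkHomotopic I ((Quiver.Path.nil.cons e).cons (Quiver.reverse e))
        (Quiver.Path.nil : QuiverWalk b b) := by
      rcases e with α | α
      · exact WalkHomotopic.arrow_inv α
      · exact WalkHomotopic.inv_arrow α
    have h' := WalkHomotopic.comp p p.reverse h
    have e' : (p.cons e).comp (p.cons e).reverse =
        (p.comp ((Quiver.Path.nil.cons e).cons (Quiver.reverse e))).comp p.reverse := by
      rw [Quiver.Path.reverse, ← Quiver.Path.comp_assoc]
      rfl
    rw [e']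
    exact h'.trans ih

theorem reverse_comp {x y : Quiver.Symmetrify V} (p : QuiverWalk x y) :
    WalkHomotopic I (p.reverse.comp p) Quiver.Path.nil := by
  simpa only [Quiver.Path.reverse_reverse] using comp_reverse (I := I) p.reverse

theorem reverse_congr {x y : Quiver.Symmetrify V} {p q : QuiverWalk x y}
    (h : WalkHomotopic I p q) : WalkHomotopic I p.reverse q.reverse := by
  have h₁ : WalkHomotopic I p.reverse (p.reverse.comp (q.comp q.reverse)) :=
    ((comp_reverse q).comp_left p.reverse).symm
  have h₂ : WalkHomotopic I (p.reverse.comp (q.comp q.reverse))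
      (p.reverse.comp (p.comp q.reverse)) := (h.symm.comp_right q.reverse).comp_left p.reverse
  have h₃ := (reverse_comp (I := I) p).comp_right q.reverse
  rw [Quiver.Path.nil_comp, Quiver.Path.comp_assoc] at h₃
  exact h₁.trans (h₂.trans h₃)

variable (I) in
/-- Homotopy of closed walks at `x`. -/
def setoid (x : Quiver.Symmetrify V) : Setoid (QuiverWalk x x) where
  r p q := WalkHomotopic I p q
  iseqv := ⟨WalkHomotopic.refl, WalkHomotopic.symm, WalkHomotopic.trans⟩

end WalkHomotopic

/-- The fundamental group `π₁(Q, I, x)`: closed walks at `x` up to homotopy. -/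
def QuiverFundamentalGroup {k : Type u} {V : Type v} [Field k] [Quiver.{w} V] [Fintype V]
    (I : Ideal (PathAlgebra k V)) (x : V) : Type (max v w) :=
  Quotient (WalkHomotopic.setoid I (Quiver.symVertex x))

/-- The product of homotopy classes is induced by the composition of walks. -/
instance {k : Type u} {V : Type v} [Field k] [Quiver.{w} V] [Fintype V]
    (I : Ideal (PathAlgebra k V)) (x : V) : Group (QuiverFundamentalGroup I x) where
  mul := Quotient.map₂ (fun p q => p.comp q) fun _ _ h _ _ h' => WalkHomotopic.comp_congr h h'
  one := Quotient.mk _ Quiver.Path.nil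
  inv := Quotient.map (fun p => p.reverse) fun _ _ h => WalkHomotopic.reverse_congr h
  mul_assoc := by
    rintro ⟨p⟩ ⟨q⟩ ⟨r⟩
    exact congrArg (Quotient.mk _) (Quiver.Path.comp_assoc p q r)
  one_mul := by
    rintro ⟨p⟩
    exact congrArg (Quotient.mk _) (Quiver.Path.nil_comp p)
  mul_one := by
    rintro ⟨p⟩
    exact congrArg (Quotient.mk _) (Quiver.Path.comp_nil p)
  inv_mul_cancel := by
    rintro ⟨p⟩
    exact Quotient.sound (WalkHomotopic.reverse_comp p)

/-! ### Algebras and their presentations -/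

/-- The quiver has finitely many arrows (its vertex set is finite by the instance), is nonempty and
its underlying graph is connected. -/
structure IsFiniteConnectedQuiver (V : Type v) [Quiver.{w} V] [Fintype V] : Prop where
  finite_hom : ∀ a b : V, Finite (a ⟶ b)
  nonempty : Nonempty V
  connected : ∀ a b : V, Nonempty (QuiverWalk (Quiver.symVertex a) (Quiver.symVertex b))

/-- The quiver has no oriented cycles (in particular no loops). -/
def IsAcyclicQuiver (V : Type v) [Quiver.{w} V] : Prop :=
  ∀ (a : V) (p : Quiver.Path a a), p.length = 0

/-- A presentation of the algebra `A`: a surjective morphism `kQ → A` of `k`-algebras whose kernel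
is an admissible ideal. -/
structure IsPresentation {k : Type u} {V : Type v} [Field k] [Quiver.{w} V] [Fintype V]
    {A : Type*} [Ring A] [Algebra k A] (ν : PathAlgebra k V →ₐ[k] A) : Prop where
  surjective : Function.Surjective ν
  admissible : PathAlgebra.IsAdmissible (RingHom.ker ν)

/-- A finite-dimensional algebra over an algebraically closed field `k` is basic if `A / rad A` is a
finite product of copies of `k`. -/
def IsBasicAlgebra (k : Type u) [Field k] (A : Type*) [Ring A] [Algebra k A] : Prop :=
  ∃ r : ℕ, Nonempty ((A ⧸ Ring.jacobson A) ≃ₐ[k] (Fin r → k))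

/-- A ring is connected if it is nonzero and its only central idempotents are `0` and `1`, that is,
it is not a product of two nonzero rings. -/
structure IsConnectedAlgebra (A : Type*) [Ring A] : Prop where
  nontrivial : Nontrivial A
  eq_zero_or_one : ∀ e : A, e * e = e → (∀ a : A, e * a = a * e) → e = 0 ∨ e = 1

/-- `A` is a basic connected finite-dimensional `k`-algebra which is triangular, with quiver `V`:
the finite connected quiver `V` of `A` has no oriented cycles. -/
structure IsTriangularAlgebra (k : Type u) [Field k] (A : Type*) [Ring A] [Algebra k A]
    (V : Type v) [Quiver.{w} V] [Fintype V] : Prop where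
  finiteDimensional : FiniteDimensional k A
  basic : IsBasicAlgebra k A
  connected : IsConnectedAlgebra A
  quiver : IsFiniteConnectedQuiver V
  acyclic : IsAcyclicQuiver V
  exists_presentation : ∃ ν : PathAlgebra k V →ₐ[k] A, IsPresentation ν

/-! ### The class of groups -/

/-- The smallest class of groups (up to isomorphism) which contains the cyclic groups and is closed
under free products and direct products of two groups. -/
inductive CyclicProductClass : (G : Type u) → [Group G] → Prop
  | cyclic (G : Type u) [Group G] (h : IsCyclic G) : CyclicProductClass G
  | coprod (G H : Type u) [Group G] [Group H] :
      CyclicProductClass G → CyclicProductClass H → CyclicProductClass (Monoid.Coprod G H)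
  | prod (G H : Type u) [Group G] [Group H] :
      CyclicProductClass G → CyclicProductClass H → CyclicProductClass (G × H)
  | congr (G H : Type u) [Group G] [Group H] (e : G ≃* H) :
      CyclicProductClass G → CyclicProductClass H

end

noncomputable section

/-! In a quiver with three consecutive vertices and two bunches of parallel arrows, both labelled by
a finite set, a path of length two is a product of two labels. If one label, `none`, plays the unit,
identifying the path `(x, y)` with `(z, none)` imposes the relator `x y = z`, and identifying `(s,
none)` with `(none, s)` makes the two arrows labelled `s` represent the same element. So any group
with a finite presentation by relators `x y = z` can be encoded. Every group of the class has one: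
`CyclicProductClass.hasTrianglePresentation`.

The algebra `A` encodes all `G i` at once: the labels are `none` and the disjoint union of the
generating sets, and the paths of length two map onto a basis of the corner of `A`, identified as
the relators demand. To isolate `G i`, only the presentation of `A` is changed, by a transvection. A
first-step arrow whose label `s` belongs to another group is sent to `s - c • none`, with `c ≠ 0,
1`. The commutation relation then becomes `(s, none) + c (none, none) - (none, s)`. Since `c ≠ 1`,
no path of length two lies in the kernel, so a relation with two or three terms is automatically
minimal. The new term makes `(s, none)` homotopic to `(none, none)`, which kills `s`
(`WalkHomotopic.of_three_term`, `walkHomotopic_swap`).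

Nothing else collapses, because `A` is graded by `G i`: labels of `G i` have their value as degree,
all other labels have degree `1`. The transvection respects this grading, hence the kernel and its
minimal relations are homogeneous, and the degree of a walk is a homotopy invariant
(`walkDegree_eq_of_walkHomotopic`). The degree map and the map supplied by the presentation of `G i`
are mutually inverse (`nonempty_fundamentalGroup_mulEquiv`). -/

/-! ### Finite presentations with relators of the form `x y = z` -/

/-- The family `g` generates `G`, and `G` is presented on it by the relators `x y = z` for
`R x y z`. The universal property is only required for groups in `Type`. -/
structure IsTrianglePresentation {G : Type v} [Group G] {S : Type} (g : S → G)
    (R : S → S → S → Prop) : Prop where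
  mul_eq : ∀ x y z, R x y z → g x * g y = g z
  closure_eq_top : Subgroup.closure (Set.range g) = ⊤
  exists_hom : ∀ (H : Type) [Group H] (f : S → H), (∀ x y z, R x y z → f x * f y = f z) →
    ∃ F : G →* H, ∀ s, F (g s) = f s

/-- The group `G` has a finite presentation all of whose relators have the form `x y = z`. -/
def HasTrianglePresentation (G : Type v) [Group G] : Prop :=
  ∃ (S : Type) (_ : Finite S) (g : S → G) (R : S → S → S → Prop), IsTrianglePresentation g R

namespace HasTrianglePresentation

theorem of_mulEquiv {G : Type u} {H : Type v} [Group G] [Group H] (e : G ≃* H)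
    (hG : HasTrianglePresentation G) : HasTrianglePresentation H := by
  obtain ⟨S, hS, g, R, h⟩ := hG
  refine ⟨S, hS, e ∘ g, R, fun x y z hR => ?_, ?_, fun K _ f hf => ?_⟩
  · simp [← map_mul, h.mul_eq x y z hR]
  · have := e.toMonoidHom.map_closure (Set.range g)
    rw [h.closure_eq_top, Subgroup.map_top_of_surjective _ e.surjective, ← Set.range_comp] at this
    exact this.symm
  · obtain ⟨F, hF⟩ := h.exists_hom K f hf
    exact ⟨F.comp e.symm.toMonoidHom, fun s => by simp [hF]⟩

/-- The whole multiplication table serves as the set of relators. -/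
theorem of_finite (G : Type v) [Group G] [Finite G] : HasTrianglePresentation G := by
  let e : G ≃ Fin (Nat.card G) := Finite.equivFin G
  refine ⟨Fin (Nat.card G), inferInstance, e.symm, fun x y z => e.symm x * e.symm y = e.symm z,
    fun _ _ _ h => h, ?_, fun H _ f hf => ?_⟩
  · rw [e.symm.surjective.range_eq, Subgroup.closure_univ]
  · exact ⟨MonoidHom.mk' (fun a => f (e a)) fun a b => (hf _ _ _ (by simp)).symm,
      fun s => by simp⟩

theorem multiplicativeInt : HasTrianglePresentation (Multiplicative ℤ) := by
  refine ⟨Unit, inferInstance, fun _ => Multiplicative.ofAdd 1, fun _ _ _ => False,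
    fun _ _ _ h => h.elim, ?_, fun H _ f _ => ?_⟩
  swap
  · exact ⟨zpowersHom H (f ()), fun _ => by simp⟩
  rw [Subgroup.eq_top_iff']
  intro a
  have h : a = Multiplicative.ofAdd (1 : ℤ) ^ (Multiplicative.toAdd a) := by
    rw [← ofAdd_zsmul]
    simp
  rw [h]
  exact Subgroup.zpow_mem _ (Subgroup.subset_closure (Set.mem_range_self ())) _

theorem of_isCyclic (G : Type v) [Group G] (h : IsCyclic G) : HasTrianglePresentation G := by
  cases finite_or_infinite G
  · exact of_finite G
  · have e := zmodCyclicMulEquiv h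
    rw [Nat.card_eq_zero_of_infinite] at e
    exact multiplicativeInt.of_mulEquiv e

theorem coprod {G H : Type v} [Group G] [Group H] (hG : HasTrianglePresentation G)
    (hH : HasTrianglePresentation H) : HasTrianglePresentation (Monoid.Coprod G H) := by
  obtain ⟨S, hS, g, R, hg⟩ := hG
  obtain ⟨T, hT, h, Q, hh⟩ := hH
  refine ⟨S ⊕ T, inferInstance, Sum.elim (Monoid.Coprod.inl ∘ g) (Monoid.Coprod.inr ∘ h),
    fun x y z => (∃ a b c, x = .inl a ∧ y = .inl b ∧ z = .inl c ∧ R a b c) ∨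
      (∃ a b c, x = .inr a ∧ y = .inr b ∧ z = .inr c ∧ Q a b c), ?_, ?_, fun K _ f hf => ?_⟩
  · rintro _ _ _ (⟨a, b, c, rfl, rfl, rfl, hR⟩ | ⟨a, b, c, rfl, rfl, rfl, hR⟩)
    · simp [← map_mul, hg.mul_eq _ _ _ hR]
    · simp [← map_mul, hh.mul_eq _ _ _ hR]
  · rw [Set.Sum.elim_range, Subgroup.closure_union, Set.range_comp, Set.range_comp,
      ← MonoidHom.map_closure, ← MonoidHom.map_closure, hg.closure_eq_top, hh.closure_eq_top,
      ← MonoidHom.range_eq_map, ← MonoidHom.range_eq_map, Monoid.Coprod.range_inl_sup_range_inr]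
  · obtain ⟨F, hF⟩ := hg.exists_hom K (f ∘ .inl) fun x y z hR =>
      hf _ _ _ (.inl ⟨x, y, z, rfl, rfl, rfl, hR⟩)
    obtain ⟨E, hE⟩ := hh.exists_hom K (f ∘ .inr) fun x y z hR =>
      hf _ _ _ (.inr ⟨x, y, z, rfl, rfl, rfl, hR⟩)
    refine ⟨Monoid.Coprod.lift F E, ?_⟩
    rintro (s | t)
    · simp [hF]
    · simp [hE]

/-- The relator `s t = t s` does not have the required form. An extra generator `(s, t)` names the
common value, and the two relators `s t = (s, t)` and `t s = (s, t)` replace it. -/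
theorem prod {G H : Type v} [Group G] [Group H] (hG : HasTrianglePresentation G)
    (hH : HasTrianglePresentation H) : HasTrianglePresentation (G × H) := by
  obtain ⟨S, hS, g, R, hg⟩ := hG
  obtain ⟨T, hT, h, Q, hh⟩ := hH
  refine ⟨(S ⊕ T) ⊕ S × T, inferInstance,
    Sum.elim (Sum.elim (fun s => (g s, 1)) (fun t => (1, h t))) (fun p => (g p.1, h p.2)),
    fun x y z => (∃ a b c, x = .inl (.inl a) ∧ y = .inl (.inl b) ∧ z = .inl (.inl c) ∧ R a b c) ∨
      (∃ a b c, x = .inl (.inr a) ∧ y = .inl (.inr b) ∧ z = .inl (.inr c) ∧ Q a b c) ∨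
      (∃ s t, x = .inl (.inl s) ∧ y = .inl (.inr t) ∧ z = .inr (s, t)) ∨
      (∃ s t, x = .inl (.inr t) ∧ y = .inl (.inl s) ∧ z = .inr (s, t)), ?_, ?_,
    fun K _ f hf => ?_⟩
  · rintro _ _ _ (⟨a, b, c, rfl, rfl, rfl, hR⟩ | ⟨a, b, c, rfl, rfl, rfl, hR⟩ |
      ⟨s, t, rfl, rfl, rfl⟩ | ⟨s, t, rfl, rfl, rfl⟩)
    · simp [hg.mul_eq _ _ _ hR]
    · simp [hh.mul_eq _ _ _ hR]
    · simp
    · simp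
  · set C := Subgroup.closure (Set.range (Sum.elim (Sum.elim (fun s => ((g s, 1) : G × H))
      (fun t => (1, h t))) (fun p : S × T => (g p.1, h p.2)))) with hC
    have h₁ : (⊤ : Subgroup G) ≤ C.comap (MonoidHom.inl G H) := by
      rw [← hg.closure_eq_top, Subgroup.closure_le]
      rintro _ ⟨s, rfl⟩
      exact Subgroup.subset_closure ⟨.inl (.inl s), rfl⟩
    have h₂ : (⊤ : Subgroup H) ≤ C.comap (MonoidHom.inr G H) := by
      rw [← hh.closure_eq_top, Subgroup.closure_le]
      rintro _ ⟨s, rfl⟩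
      exact Subgroup.subset_closure ⟨.inl (.inr s), rfl⟩
    rw [Subgroup.eq_top_iff']
    rintro ⟨a, b⟩
    have := C.mul_mem (h₁ (Subgroup.mem_top a)) (h₂ (Subgroup.mem_top b))
    simpa using this
  · obtain ⟨F, hF⟩ := hg.exists_hom K (fun s => f (.inl (.inl s))) fun x y z hR =>
      hf _ _ _ (.inl ⟨x, y, z, rfl, rfl, rfl, hR⟩)
    obtain ⟨E, hE⟩ := hh.exists_hom K (fun t => f (.inl (.inr t))) fun x y z hR =>
      hf _ _ _ (.inr (.inl ⟨x, y, z, rfl, rfl, rfl, hR⟩))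
    have hc : ∀ s t, f (.inl (.inl s)) * f (.inl (.inr t)) = f (.inr (s, t)) := fun s t =>
      hf _ _ _ (.inr (.inr (.inl ⟨s, t, rfl, rfl, rfl⟩)))
    have hc' : ∀ s t, f (.inl (.inr t)) * f (.inl (.inl s)) = f (.inr (s, t)) := fun s t =>
      hf _ _ _ (.inr (.inr (.inr ⟨s, t, rfl, rfl, rfl⟩)))
    -- Commutation is known on generators only; it spreads to one factor at a time, since
    -- centralizers are subgroups.
    have h₁ : ∀ s b, Commute (F (g s)) (E b) := fun s b => by
      have : (⊤ : Subgroup H) ≤ (Subgroup.centralizer {F (g s)}).comap E := by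
        rw [← hh.closure_eq_top, Subgroup.closure_le]
        rintro _ ⟨t, rfl⟩
        simp only [SetLike.mem_coe, Subgroup.mem_comap, Subgroup.mem_centralizer_singleton_iff]
        rw [hE, hF, hc, hc']
      exact (Subgroup.mem_centralizer_singleton_iff.1 (this (Subgroup.mem_top b))).symm
    have h₂ : ∀ a b, Commute (F a) (E b) := fun a b => by
      have : (⊤ : Subgroup G) ≤ (Subgroup.centralizer {E b}).comap F := by
        rw [← hg.closure_eq_top, Subgroup.closure_le]
        rintro _ ⟨s, rfl⟩
        simp only [SetLike.mem_coe, Subgroup.mem_comap, Subgroup.mem_centralizer_singleton_iff]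
        exact h₁ s b
      exact Subgroup.mem_centralizer_singleton_iff.1 (this (Subgroup.mem_top a))
    refine ⟨MonoidHom.noncommCoprod F E h₂, ?_⟩
    rintro ((s | t) | ⟨s, t⟩)
    · simp [hF]
    · simp [hE]
    · simp [hF, hE, hc]

end HasTrianglePresentation

theorem CyclicProductClass.hasTrianglePresentation {G : Type v} [Group G]
    (hG : CyclicProductClass G) : HasTrianglePresentation G := by
  induction hG with
  | cyclic G h => exact .of_isCyclic G h
  | coprod G H _ _ hG hH => exact hG.coprod hH
  | prod G H _ _ hG hH => exact hG.prod hH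
  | congr G H e _ hG => exact hG.of_mulEquiv e

/-! ### The algebra of a bilinear map -/

/-- The algebra of upper triangular matrices with diagonal entries in `k`, with entries in the
modules `M`, `N` next to the diagonal and with an entry in `P` in the corner; the product is formed
by means of the bilinear map `μ : M × N → P`. -/
@[ext]
structure BilinearAlgebra {k : Type u} {M N P : Type u} [Field k] [AddCommGroup M]
    [AddCommGroup N] [AddCommGroup P] [Module k M] [Module k N] [Module k P]
    (μ : M →ₗ[k] N →ₗ[k] P) : Type u where
  diag : Fin 3 → k
  left : M
  right : N
  corner : P

namespace BilinearAlgebra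

variable {k : Type u} {M N P : Type u} [Field k] [AddCommGroup M] [AddCommGroup N]
  [AddCommGroup P] [Module k M] [Module k N] [Module k P] {μ : M →ₗ[k] N →ₗ[k] P}

variable (μ) in
/-- The entries of an element of the algebra. -/
def equivProd : BilinearAlgebra μ ≃ (Fin 3 → k) × M × N × P where
  toFun x := (x.diag, x.left, x.right, x.corner)
  invFun x := ⟨x.1, x.2.1, x.2.2.1, x.2.2.2⟩

instance : AddCommGroup (BilinearAlgebra μ) := (equivProd μ).addCommGroup

instance : Module k (BilinearAlgebra μ) := (equivProd μ).module k

variable (μ) in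
/-- The entries of an element of the algebra, as a linear equivalence. -/
def linearEquivProd : BilinearAlgebra μ ≃ₗ[k] (Fin 3 → k) × M × N × P :=
  (equivProd μ).linearEquiv k

@[simp] theorem linearEquivProd_apply (x : BilinearAlgebra μ) :
    linearEquivProd μ x = (x.diag, x.left, x.right, x.corner) := rfl

instance [Module.Finite k M] [Module.Finite k N] [Module.Finite k P] :
    Module.Finite k (BilinearAlgebra μ) :=
  Module.Finite.equiv (linearEquivProd μ).symm

instance : Mul (BilinearAlgebra μ) where
  mul x y :=
    { diag := x.diag * y.diag
      left := x.diag 0 • y.left + y.diag 1 • x.left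
      right := x.diag 1 • y.right + y.diag 2 • x.right
      corner := x.diag 0 • y.corner + μ x.left y.right + y.diag 2 • x.corner }

instance : One (BilinearAlgebra μ) := ⟨⟨1, 0, 0, 0⟩⟩

section
variable (x y : BilinearAlgebra μ) (r : k)

@[simp] theorem diag_add : (x + y).diag = x.diag + y.diag := rfl
@[simp] theorem left_add : (x + y).left = x.left + y.left := rfl
@[simp] theorem right_add : (x + y).right = x.right + y.right := rfl
@[simp] theorem corner_add : (x + y).corner = x.corner + y.corner := rfl
@[simp] theorem diag_zero : (0 : BilinearAlgebra μ).diag = 0 := rfl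
@[simp] theorem left_zero : (0 : BilinearAlgebra μ).left = 0 := rfl
@[simp] theorem right_zero : (0 : BilinearAlgebra μ).right = 0 := rfl
@[simp] theorem corner_zero : (0 : BilinearAlgebra μ).corner = 0 := rfl
@[simp] theorem diag_one : (1 : BilinearAlgebra μ).diag = 1 := rfl
@[simp] theorem left_one : (1 : BilinearAlgebra μ).left = 0 := rfl
@[simp] theorem right_one : (1 : BilinearAlgebra μ).right = 0 := rfl
@[simp] theorem corner_one : (1 : BilinearAlgebra μ).corner = 0 := rfl
@[simp] theorem diag_smul : (r • x).diag = r • x.diag := rfl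
@[simp] theorem left_smul : (r • x).left = r • x.left := rfl
@[simp] theorem right_smul : (r • x).right = r • x.right := rfl
@[simp] theorem corner_smul : (r • x).corner = r • x.corner := rfl
@[simp] theorem diag_mul : (x * y).diag = x.diag * y.diag := rfl
@[simp] theorem left_mul : (x * y).left = x.diag 0 • y.left + y.diag 1 • x.left := rfl
@[simp] theorem right_mul : (x * y).right = x.diag 1 • y.right + y.diag 2 • x.right := rfl
@[simp] theorem corner_mul :
    (x * y).corner = x.diag 0 • y.corner + μ x.left y.right + y.diag 2 • x.corner := rfl

end

instance : Ring (BilinearAlgebra μ) :=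
  { (inferInstance : AddCommGroup (BilinearAlgebra μ)) with
    mul := (· * ·)
    one := 1
    mul_assoc := fun x y z => by
      ext1
      · simp [mul_assoc]
      · simp; module
      · simp; module
      · simp; module
    one_mul := fun x => by ext1 <;> simp
    mul_one := fun x => by ext1 <;> simp
    left_distrib := fun x y z => by
      ext1
      · simp [mul_add]
      · simp; module
      · simp; module
      · simp; module
    right_distrib := fun x y z => by
      ext1
      · simp [add_mul]
      · simp; module
      · simp; module
      · simp; module
    zero_mul := fun x => by ext1 <;> simp
    mul_zero := fun x => by ext1 <;> simp }

instance : Algebra k (BilinearAlgebra μ) :=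
  Algebra.ofModule (fun r x y => by
      ext1
      · simp
      · simp; module
      · simp; module
      · simp; module)
    (fun r x y => by
      ext1
      · simp
      · simp; module
      · simp; module
      · simp; module)

variable (μ) in
/-- The projection to the diagonal. -/
def diagHom : BilinearAlgebra μ →ₐ[k] (Fin 3 → k) :=
  AlgHom.ofLinearMap (LinearMap.fst k _ _ ∘ₗ (linearEquivProd μ).toLinearMap) rfl fun _ _ => rfl

theorem diagHom_surjective : Function.Surjective (diagHom μ) := fun d => ⟨⟨d, 0, 0, 0⟩, rfl⟩

/-- These are strictly upper triangular matrices of size three. -/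
theorem mul_mul_eq_zero {x y z : BilinearAlgebra μ} (hx : x.diag = 0) (hy : y.diag = 0)
    (hz : z.diag = 0) : x * y * z = 0 := by
  ext1 <;> simp [hx, hy, hz]

/-- The diagonal algebra is semisimple, which bounds the radical from above; the kernel is a
nilpotent ideal, which bounds it from below. -/
theorem jacobson_eq_ker : Ring.jacobson (BilinearAlgebra μ) = RingHom.ker (diagHom μ) := by
  apply le_antisymm
  · intro x hx
    have : RingHomSurjective (diagHom μ).toRingHom := ⟨diagHom_surjective⟩
    have h := Ring.le_comap_jacobson (diagHom μ).toRingHom hx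
    rw [IsSemisimpleRing.jacobson_eq_bot] at h
    exact h
  · intro x hx
    rw [← Ideal.jacobson_bot, Ideal.mem_jacobson_iff]
    intro y
    have hn : (y * x).diag = 0 := by
      have : x.diag = 0 := hx
      simp [this]
    -- The inverse of `1 + y * x`, a geometric series cut off by `(y * x) ^ 3 = 0`.
    refine ⟨1 - y * x + y * x * (y * x), ?_⟩
    rw [Ideal.mem_bot, mul_assoc]
    calc _ = y * x * (y * x) * (y * x) := by noncomm_ring
      _ = 0 := mul_mul_eq_zero hn hn hn

theorem isBasicAlgebra : IsBasicAlgebra k (BilinearAlgebra μ) :=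
  ⟨3, ⟨(Ideal.quotientEquivAlgOfEq k jacobson_eq_ker).trans
    (Ideal.quotientKerAlgEquivOfSurjective diagHom_surjective)⟩⟩

/-- Commuting with nonzero elements of `M` and `N` forces equal diagonal entries, and commuting with
the diagonal idempotents kills the other entries. A central idempotent is thus an idempotent scalar.
-/
theorem isConnectedAlgebra [Nontrivial M] [Nontrivial N] :
    IsConnectedAlgebra (BilinearAlgebra μ) := by
  constructor
  · exact ⟨0, 1, fun h => by simpa using congr_fun (congrArg diag h) 0⟩
  · intro e he hc
    obtain ⟨m, hm⟩ := exists_ne (0 : M)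
    obtain ⟨n, hn⟩ := exists_ne (0 : N)
    have h₁ : e.diag 0 = e.diag 1 := by
      have := congrArg left (hc ⟨0, m, 0, 0⟩)
      simpa [smul_left_inj hm] using this
    have h₂ : e.diag 1 = e.diag 2 := by
      have := congrArg right (hc ⟨0, 0, n, 0⟩)
      simpa [smul_left_inj hn] using this
    have h₀ := hc ⟨Pi.single 0 1, 0, 0, 0⟩
    have h₃ : e.left = 0 := by simpa using (congrArg left h₀).symm
    have h₄ : e.corner = 0 := by simpa using (congrArg corner h₀).symm
    have h₅ : e.right = 0 := by
      simpa using (congrArg right (hc ⟨Pi.single 2 1, 0, 0, 0⟩))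
    have h₆ : e.diag 0 * e.diag 0 = e.diag 0 := congr_fun (congrArg diag he) 0
    have h₇ : e.diag = fun _ => e.diag 0 := by
      ext i
      fin_cases i
      · rfl
      · exact h₁.symm
      · exact (h₁.trans h₂).symm
    rcases IsIdempotentElem.iff_eq_zero_or_one.1 h₆ with h | h
    · left
      ext1
      · rw [h₇, h]; rfl
      all_goals simpa
    · right
      ext1
      · rw [h₇, h]; rfl
      all_goals simpa

end BilinearAlgebra

/-! ### Algebra morphisms out of the path algebra -/

namespace PathAlgebra

variable {k : Type u} {V : Type v} [Field k] [Quiver.{w} V]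

theorem submodule_eq_top {N : Submodule k (PathAlgebra k V)}
    (h : ∀ (a b : V) (p : Quiver.Path a b), ofPath k p ∈ N) : N = ⊤ := by
  rw [eq_top_iff, ← (basis k V).span_eq, Submodule.span_le]
  rintro _ ⟨⟨a, b, p⟩, rfl⟩
  exact h a b p

variable {B : Type*} [Ring B] (e : V → B) (f : ∀ {a b : V}, (a ⟶ b) → B)

/-- The product of the images of the arrows along a path. -/
def pathProd {a : V} : ∀ {b : V}, Quiver.Path a b → B
  | _, .nil => e a
  | _, .cons p α => pathProd p * f α

/-- The images of the stationary paths and of the arrows define a representation of the path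
algebra. -/
structure IsArrowSystem [Fintype V] : Prop where
  idem : ∀ a, e a * e a = e a
  orthogonal : ∀ a b, a ≠ b → e a * e b = 0
  sum_eq_one : ∑ a, e a = 1
  source : ∀ {a b : V} (α : a ⟶ b), e a * f α = f α
  target : ∀ {a b : V} (α : a ⟶ b), f α * e b = f α

variable {e f} [Fintype V]

theorem IsArrowSystem.mul_pathProd (h : IsArrowSystem e @f) {a b : V} (p : Quiver.Path a b) :
    e a * pathProd e @f p = pathProd e @f p := by
  induction p with
  | nil => exact h.idem a
  | cons p α ih => rw [pathProd, ← mul_assoc, ih]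

theorem IsArrowSystem.pathProd_mul (h : IsArrowSystem e @f) {a b : V} (p : Quiver.Path a b) :
    pathProd e @f p * e b = pathProd e @f p := by
  cases p with
  | nil => exact h.idem a
  | cons p α => rw [pathProd, mul_assoc, h.target]

theorem IsArrowSystem.pathProd_comp (h : IsArrowSystem e @f) {a b c : V} (p : Quiver.Path a b)
    (q : Quiver.Path b c) :
    pathProd e @f (p.comp q) = pathProd e @f p * pathProd e @f q := by
  induction q with
  | nil => exact (h.pathProd_mul p).symm
  | cons q α ih => rw [Quiver.Path.comp_cons, pathProd, pathProd, ih, mul_assoc]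

variable [Algebra k B]

variable (k e f) in
/-- The linear extension of `pathProd`. -/
def liftLinear : PathAlgebra k V →ₗ[k] B :=
  (basis k V).constr k fun p => pathProd e @f p.2.2

theorem liftLinear_ofPath {a b : V} (p : Quiver.Path a b) :
    liftLinear k e @f (ofPath k p) = pathProd e @f p := by
  simp [liftLinear, ofPath, Module.Basis.constr_basis]

/-- The morphism from the path algebra with given values on stationary paths and on arrows. -/
def lift (h : IsArrowSystem e @f) : PathAlgebra k V →ₐ[k] B :=
  AlgHom.ofLinearMap (liftLinear k e @f)
    (by simp only [one_def, map_sum, liftLinear_ofPath]; exact h.sum_eq_one)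
    (fun x y => by
      have H : (mulMap k (V := V)).compr₂ (liftLinear k e @f) =
          (LinearMap.mul k B).compl₁₂ (liftLinear k e @f) (liftLinear k e @f) := by
        refine hom_ext fun a b p => hom_ext fun c d q => ?_
        change liftLinear k e @f (ofPath k p * ofPath k q) =
          liftLinear k e @f (ofPath k p) * liftLinear k e @f (ofPath k q)
        by_cases hc : c = b
        · subst hc
          simp only [ofPath_mul_ofPath, liftLinear_ofPath, h.pathProd_comp]
        -- For paths that do not compose, the product of the images contains the factor `e b * e c =
        -- 0`.
        · rw [ofPath_mul_ofPath_of_ne _ _ hc, map_zero, liftLinear_ofPath, liftLinear_ofPath,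
            ← h.pathProd_mul p, ← h.mul_pathProd q, mul_assoc, ← mul_assoc (e b),
            h.orthogonal b c (Ne.symm hc), zero_mul, mul_zero]
      exact LinearMap.congr_fun (LinearMap.congr_fun H x) y)

theorem lift_ofPath {h : IsArrowSystem e @f} {a b : V} (p : Quiver.Path a b) :
    lift (k := k) h (ofPath k p) = pathProd e @f p :=
  liftLinear_ofPath p

end PathAlgebra

/-! ### Degrees of walks -/

section Degree

variable {V : Type v} [Quiver.{w} V] {H : Type*} [Group H] (d : ∀ {a b : V}, (a ⟶ b) → H)

/-- The degree of an arrow or of a formal inverse of an arrow. -/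
def stepDegree {x y : Quiver.Symmetrify V} (e : x ⟶ y) : H :=
  Sum.elim (fun α : Quiver.Hom (V := V) x y => d α)
    (fun α : Quiver.Hom (V := V) y x => (d α)⁻¹) e

/-- The degree of a walk, given the degrees of arrows. -/
def walkDegree {x : Quiver.Symmetrify V} : ∀ {y : Quiver.Symmetrify V}, QuiverWalk x y → H
  | _, .nil => 1
  | _, .cons p e => walkDegree p * stepDegree @d e

@[simp] theorem walkDegree_nil {x : Quiver.Symmetrify V} :
    walkDegree @d (.nil : QuiverWalk x x) = 1 := rfl

@[simp] theorem walkDegree_cons {x y z : Quiver.Symmetrify V} (p : QuiverWalk x y) (e : y ⟶ z) :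
    walkDegree @d (p.cons e) = walkDegree @d p * stepDegree @d e := rfl

@[simp] theorem walkDegree_comp {x y z : Quiver.Symmetrify V} (p : QuiverWalk x y)
    (q : QuiverWalk y z) : walkDegree @d (p.comp q) = walkDegree @d p * walkDegree @d q := by
  induction q with
  | nil => simp
  | cons q e ih => rw [Quiver.Path.comp_cons, walkDegree_cons, walkDegree_cons, ih, mul_assoc]

variable {k : Type u} [Field k] [Fintype V] {I : Ideal (PathAlgebra k V)}

/-- The degree is homotopy invariant if minimal relations are homogeneous. -/
theorem WalkHomotopic.walkDegree_eq
    (hI : ∀ {x y : V} (c : Quiver.Path x y →₀ k), PathAlgebra.IsMinimalRelation I c →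
      ∀ p ∈ c.support, ∀ q ∈ c.support, walkDegree @d p.toWalk = walkDegree @d q.toWalk)
    {x y : Quiver.Symmetrify V} {p q : QuiverWalk x y} (h : WalkHomotopic I p q) :
    walkDegree @d p = walkDegree @d q := by
  induction h with
  | refl => rfl
  | symm _ ih => exact ih.symm
  | trans _ _ ih ih' => exact ih.trans ih'
  | arrow_inv α => exact (congrArg (· * _) (one_mul (d α))).trans (mul_inv_cancel _)
  | inv_arrow α => exact (congrArg (· * _) (one_mul (d α)⁻¹)).trans (inv_mul_cancel _)
  | minimal c hc p q hp hq => exact hI c hc p hp q hq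
  | comp s t _ ih => simp [ih]

open PathAlgebra in
/-- If the kernel of `ν` is homogeneous, then so are the minimal relations of it. -/
theorem PathAlgebra.IsMinimalRelation.walkDegree_eq {A : Type*} [Ring A] [Algebra k A]
    {ν : PathAlgebra k V →ₐ[k] A} (π : H → A →ₗ[k] A)
    (hπ : ∀ {x y : V} (p : Quiver.Path x y), π (walkDegree @d p.toWalk) (ν (ofPath k p)) =
      ν (ofPath k p))
    (hπ' : ∀ {x y : V} (p : Quiver.Path x y) (h : H), walkDegree @d p.toWalk ≠ h →
      π h (ν (ofPath k p)) = 0)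
    {x y : V} {c : Quiver.Path x y →₀ k} (hc : IsMinimalRelation (RingHom.ker ν) c)
    {p q : Quiver.Path x y} (hp : p ∈ c.support) (hq : q ∈ c.support) :
    walkDegree @d p.toWalk = walkDegree @d q.toWalk := by
  classical
  by_contra hne
  -- The terms with the degree of `p` form a proper partial sum, as `q` is left out. Its image under
  -- `ν` is a homogeneous component of `0`, contradicting minimality.
  set J := c.support.filter fun w => walkDegree @d w.toWalk = walkDegree @d p.toWalk with hJ
  refine hc.notMem J ?_ ⟨p, Finset.mem_filter.2 ⟨hp, rfl⟩⟩ ?_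
  · refine Finset.filter_ssubset.2 ⟨q, hq, fun h => hne h.symm⟩
  · have h := hc.mem
    rw [RingHom.mem_ker] at h ⊢
    have h' := congrArg (π (walkDegree @d p.toWalk)) h
    rw [map_zero] at h'
    rw [← h', hJ, Finset.sum_filter]
    simp only [map_sum]
    refine Finset.sum_congr rfl fun w _ => ?_
    split_ifs with hw
    · rw [map_smul, map_smul, ← hw, hπ]
    · rw [map_smul, map_smul, hπ' w _ hw, smul_zero, map_zero]

end Degree

/-! ### Relations with at most three terms -/

-- Among at most three terms, a proper nonempty part or its complement consists of a single term,
-- and a single term in `I` would put a path into `I`.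
open PathAlgebra in
theorem PathAlgebra.isMinimalRelation_of_card_le_three {k : Type u} {V : Type v} [Field k]
    [Quiver.{w} V] [Fintype V] {I : Ideal (PathAlgebra k V)} {x y : V}
    (hI : ∀ w : Quiver.Path x y, ofPath k w ∉ I) {c : Quiver.Path x y →₀ k}
    (h₂ : 2 ≤ c.support.card) (h₃ : c.support.card ≤ 3)
    (hc : ∑ w ∈ c.support, c w • ofPath k w ∈ I) : IsMinimalRelation I c := by
  classical
  have key : ∀ J ⊆ c.support, J.card = 1 → ∑ w ∈ J, c w • ofPath k w ∉ I := by
    intro J hJ h1 hmem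
    obtain ⟨w, rfl⟩ := Finset.card_eq_one.1 h1
    have hw : c w ≠ 0 := Finsupp.mem_support_iff.1 (hJ (Finset.mem_singleton_self w))
    rw [Finset.sum_singleton] at hmem
    have := Submodule.smul_of_tower_mem I (c w)⁻¹ hmem
    rw [smul_smul, inv_mul_cancel₀ hw, one_smul] at this
    exact hI w this
  refine ⟨h₂, hc, fun J hJ hne hmem => ?_⟩
  have hlt := Finset.card_lt_card hJ
  have hpos := hne.card_pos
  by_cases h1 : J.card = 1
  · exact key J hJ.1 h1 hmem
  · refine key (c.support \ J) Finset.sdiff_subset ?_ ?_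
    · rw [Finset.card_sdiff_of_subset hJ.1]
      omega
    · have := Finset.sum_sdiff (f := fun w => c w • ofPath k w) hJ.1
      rw [← this] at hc
      exact (Submodule.add_mem_iff_left _ hmem).1 hc

-- The coefficient `l` may vanish, so that relations with two terms and with three terms are treated
-- together.
open PathAlgebra in
theorem WalkHomotopic.of_three_term {k : Type u} {V : Type v} [Field k]
    [Quiver.{w} V] [Fintype V] {I : Ideal (PathAlgebra k V)} {x y : V}
    (hI : ∀ w : Quiver.Path x y, ofPath k w ∉ I) {p q r : Quiver.Path x y} (hpq : p ≠ q)
    (hpr : p ≠ r) (hqr : q ≠ r) (l : k)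
    (h : ofPath k p + l • ofPath k r - ofPath k q ∈ I) :
    WalkHomotopic I p.toWalk q.toWalk ∧ (l ≠ 0 → WalkHomotopic I p.toWalk r.toWalk) := by
  classical
  set c : Quiver.Path x y →₀ k := Finsupp.single p 1 + Finsupp.single r l - Finsupp.single q 1
    with hc
  have hsub : c.support ⊆ {p, q, r} := by
    intro w hw
    by_contra hn
    simp only [Finset.mem_insert, Finset.mem_singleton, not_or] at hn
    refine Finsupp.mem_support_iff.1 hw ?_
    simp [hc, Ne.symm hn.1, Ne.symm hn.2.1, Ne.symm hn.2.2]
  have hp : p ∈ c.support := by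
    simp [hc, hpq.symm, hpr.symm]
  have hq : q ∈ c.support := by
    simp [hc, hpq, hqr.symm]
  have hr : l ≠ 0 → r ∈ c.support := fun hl => by
    simp [hc, hpr, hqr, hl]
  have hsum : ∑ w ∈ c.support, c w • ofPath k w =
      ofPath k p + l • ofPath k r - ofPath k q := by
    change Finsupp.linearCombination k (fun w => ofPath k w) c = _
    simp [hc]
  have hmin : IsMinimalRelation I c := by
    refine isMinimalRelation_of_card_le_three hI ?_ ?_ (hsum ▸ h)
    · rw [← Finset.card_pair hpq]
      exact Finset.card_le_card (by simp [Finset.insert_subset_iff, hp, hq])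
    · exact (Finset.card_le_card hsub).trans Finset.card_le_three
  exact ⟨.minimal c hmin p q hp hq, fun hl => .minimal c hmin p r hp (hr hl)⟩

/-! ### The quiver with two bunches of parallel arrows -/

/-- The vertices of the quiver `source ⟶ middle ⟶ target` whose arrows in each step are labelled by
`O`. -/
inductive TwoStep (O : Type) : Type
  | source
  | middle
  | target

namespace TwoStep

variable {O : Type}

instance : DecidableEq (TwoStep O)
  | source, source | middle, middle | target, target => isTrue rfl
  | source, middle | source, target | middle, source | middle, target | target, source
  | target, middle => isFalse nofun

instance : Fintype (TwoStep O) where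
  elems := {source, middle, target}
  complete := by rintro (_ | _ | _) <;> simp

/-- The arrows of the two step quiver. -/
inductive Arrow (O : Type) : TwoStep O → TwoStep O → Type
  | fst (s : O) : Arrow O source middle
  | snd (s : O) : Arrow O middle target

instance : Quiver (TwoStep O) := ⟨Arrow O⟩

/-- The arrow of the first step with label `s`. -/
abbrev fst (s : O) : (source : TwoStep O) ⟶ middle := Arrow.fst s

/-- The arrow of the second step with label `s`. -/
abbrev snd (s : O) : (middle : TwoStep O) ⟶ target := Arrow.snd s

/-- The path of length two with given labels. -/
abbrev long (s t : O) : Quiver.Path (source : TwoStep O) target := (fst s).toPath.cons (snd t)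

theorem path_cases {motive : ∀ {a b : TwoStep O}, Quiver.Path a b → Prop}
    (nil : ∀ a : TwoStep O, motive (Quiver.Path.nil : Quiver.Path a a))
    (fst : ∀ s : O, motive (fst s).toPath) (snd : ∀ s : O, motive (snd s).toPath)
    (long : ∀ s t : O, motive (long s t)) {a b : TwoStep O} (p : Quiver.Path a b) :
    motive p := by
  rcases p with _ | ⟨p, ⟨s⟩ | ⟨s⟩⟩
  · exact nil a
  · rcases p with _ | ⟨p, ⟨⟩ | ⟨⟩⟩
    exact fst s
  · rcases p with _ | ⟨p, ⟨t⟩ | ⟨⟩⟩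
    · exact snd s
    · rcases p with _ | ⟨p, ⟨⟩ | ⟨⟩⟩
      exact long t s

/-- A path from `source` to `target` has length two. -/
theorem exists_eq_long (p : Quiver.Path (source : TwoStep O) target) : ∃ s t, p = long s t := by
  rcases p with _ | ⟨p, ⟨⟩ | ⟨t⟩⟩
  rcases p with _ | ⟨p, ⟨s⟩ | ⟨⟩⟩
  rcases p with _ | ⟨p, ⟨⟩ | ⟨⟩⟩
  exact ⟨s, t, rfl⟩

theorem long_injective {s t s' t' : O} (h : long s t = long s' t') : s = s' ∧ t = t' := by
  cases h
  exact ⟨rfl, rfl⟩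

/-- The position of a vertex. -/
def level : TwoStep O → Fin 3
  | source => 0
  | middle => 1
  | target => 2

theorem isAcyclicQuiver : IsAcyclicQuiver (TwoStep O) := by
  intro a p
  rcases p with _ | ⟨p, ⟨s⟩ | ⟨s⟩⟩
  · rfl
  · rcases p with _ | ⟨p, ⟨⟩ | ⟨⟩⟩
  · rcases p with _ | ⟨p, ⟨t⟩ | ⟨⟩⟩
    rcases p with _ | ⟨p, ⟨⟩ | ⟨⟩⟩

/-- The walk from `source` to a vertex along the arrows labelled by `o`. -/
def treeWalk (o : O) : ∀ a : TwoStep O,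
    QuiverWalk (Quiver.symVertex (source : TwoStep O)) (Quiver.symVertex a)
  | source => .nil
  | middle => (fst o).toPath.toWalk
  | target => (long o o).toWalk

theorem isFiniteConnectedQuiver [Finite O] (o : O) : IsFiniteConnectedQuiver (TwoStep O) where
  finite_hom a b := by
    let F : (a ⟶ b) → O := fun e => match e with
      | .fst s => s
      | .snd s => s
    refine Finite.of_injective F ?_
    rintro (s | s) (t | t) h
    · exact congrArg Arrow.fst h
    · exact congrArg Arrow.snd h
  nonempty := ⟨source⟩
  connected a b := ⟨(treeWalk o a).reverse.comp (treeWalk o b)⟩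

/-! ### Presentations of the algebra of a multiplication table -/

open PathAlgebra BilinearAlgebra

variable {S : Type} {C : Type} {k : Type u} [Field k]

/-- The bilinear map given on basis vectors by `κ`. -/
def tableMap (k : Type u) [Field k] {O C : Type} (κ : O → O → C) :
    (O →₀ k) →ₗ[k] (O →₀ k) →ₗ[k] (C →₀ k) :=
  Finsupp.linearCombination k fun s => Finsupp.linearCombination k fun t =>
    Finsupp.single (κ s t) 1

@[simp] theorem tableMap_single (κ : O → O → C) (s t : O) (a b : k) :
    tableMap k κ (Finsupp.single s a) (Finsupp.single t b) = Finsupp.single (κ s t) (a * b) := by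
  simp [tableMap]

variable (κ : Option S → Option S → C) (l : Option S → k)

/-- The image of a stationary path. -/
def vertexImage (a : TwoStep (Option S)) : BilinearAlgebra (tableMap k κ) :=
  ⟨Pi.single a.level 1, 0, 0, 0⟩

/-- The image of an arrow: in the first step, a multiple of the arrow with label `none` is
subtracted. -/
def arrowImage : ∀ {a b : TwoStep (Option S)}, (a ⟶ b) → BilinearAlgebra (tableMap k κ)
  | _, _, .fst s => ⟨0, Finsupp.single s 1 - Finsupp.single none (l s), 0, 0⟩
  | _, _, .snd s => ⟨0, 0, Finsupp.single s 1, 0⟩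

theorem isArrowSystem : IsArrowSystem (vertexImage (k := k) κ) (arrowImage κ l) where
  idem a := by ext1 <;> simp [vertexImage, ← Pi.single_mul]
  orthogonal a b hab := by
    have h : a.level ≠ b.level := by
      revert a b
      rintro (_ | _ | _) (_ | _ | _) <;> simp [level]
    ext1
    · ext j
      simp only [vertexImage, diag_mul, Pi.mul_apply, diag_zero, Pi.zero_apply, Pi.single_apply]
      split_ifs with h₁ h₂ <;> simp_all
    all_goals simp [vertexImage]
  sum_eq_one := by
    have : (Finset.univ : Finset (TwoStep (Option S))) = {source, middle, target} := rfl
    rw [this]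
    ext1
    · ext j
      fin_cases j <;> simp [vertexImage, level]
    all_goals simp [vertexImage]
  source := by
    rintro _ _ (s | s) <;> ext1 <;> simp [vertexImage, arrowImage, level]
  target := by
    rintro _ _ (s | s) <;> ext1 <;> simp [vertexImage, arrowImage, level]

/-- The morphism from the path algebra to the algebra of the table `κ`, which is the canonical one
up to the transvection with coefficients `l`. -/
def tableHom : PathAlgebra k (TwoStep (Option S)) →ₐ[k] BilinearAlgebra (tableMap k κ) :=
  PathAlgebra.lift (isArrowSystem κ l)

theorem tableHom_nil (a : TwoStep (Option S)) :
    tableHom κ l (ofPath k (.nil : Quiver.Path a a)) = ⟨Pi.single a.level 1, 0, 0, 0⟩ :=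
  lift_ofPath _

theorem tableHom_fst (s : Option S) : tableHom κ l (ofPath k (fst s).toPath) =
    ⟨0, Finsupp.single s 1 - Finsupp.single none (l s), 0, 0⟩ := by
  refine (lift_ofPath _).trans ?_
  exact (isArrowSystem κ l).source (fst s)

theorem tableHom_snd (s : Option S) : tableHom κ l (ofPath k (snd s).toPath) =
    ⟨0, 0, Finsupp.single s 1, 0⟩ := by
  refine (lift_ofPath _).trans ?_
  exact (isArrowSystem κ l).source (snd s)

theorem ofPath_long (s t : O) :
    ofPath k (long s t) = ofPath k (fst s).toPath * ofPath k (snd t).toPath :=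
  (ofPath_mul_ofPath (fst s).toPath (snd t).toPath).symm

theorem tableHom_long (s t : Option S) : tableHom κ l (ofPath k (long s t)) =
    ⟨0, 0, 0, Finsupp.single (κ s t) 1 - Finsupp.single (κ none t) (l s)⟩ := by
  rw [ofPath_long, map_mul, tableHom_fst, tableHom_snd]
  ext1 <;> simp

/-! ### Admissibility -/

theorem diag_tableHom {f : PathAlgebra k (TwoStep (Option S))}
    (hf : f ∈ arrowIdeal k (TwoStep (Option S))) : (tableHom κ l f).diag = 0 := by
  let φ : PathAlgebra k (TwoStep (Option S)) →+* (Fin 3 → k) :=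
    ((diagHom (tableMap k κ)).comp (tableHom κ l)).toRingHom
  have h : TwoSidedIdeal.span {f : PathAlgebra k (TwoStep (Option S)) |
      ∃ (a b : _) (α : a ⟶ b), f = ofPath k α.toPath} ≤ TwoSidedIdeal.ker φ := by
    rw [TwoSidedIdeal.span_le]
    rintro _ ⟨a, b, α, rfl⟩
    rw [SetLike.mem_coe, TwoSidedIdeal.mem_ker]
    rcases α with s | s
    · exact congrArg diag (tableHom_fst κ l s)
    · exact congrArg diag (tableHom_snd κ l s)
  exact (TwoSidedIdeal.mem_ker φ).1 (h (TwoSidedIdeal.mem_asIdeal.1 hf))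

/-- Elements of the arrow ideal have zero diagonal, and three such factors multiply to zero. -/
theorem arrowIdeal_pow_three_le :
    arrowIdeal k (TwoStep (Option S)) ^ 3 ≤ RingHom.ker (tableHom κ l) := by
  have h₂ : ∀ f ∈ arrowIdeal k (TwoStep (Option S)) ^ 2, ∀ g ∈ arrowIdeal k (TwoStep (Option S)),
      tableHom κ l f * tableHom κ l g = 0 := by
    intro f hf g hg
    rw [Submodule.pow_succ, Submodule.pow_one] at hf
    refine Submodule.mul_induction_on hf (fun a ha b hb => ?_) fun a b ha hb => ?_
    · rw [map_mul]
      exact mul_mul_eq_zero (diag_tableHom κ l ha) (diag_tableHom κ l hb) (diag_tableHom κ l hg)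
    · rw [map_add, add_mul, ha, hb, add_zero]
  rw [Submodule.pow_succ, Ideal.mul_le]
  intro f hf g hg
  rw [RingHom.mem_ker, map_mul]
  exact h₂ f hf g hg

theorem ofPath_toPath_mem_arrowIdeal {V : Type v} [Quiver.{w} V] [Fintype V] {a b : V}
    (α : a ⟶ b) : ofPath k α.toPath ∈ arrowIdeal k V :=
  TwoSidedIdeal.mem_asIdeal.2 (TwoSidedIdeal.subset_span ⟨a, b, α, rfl⟩)

variable {l}

/-- Modulo paths of length two, an element can be recovered linearly from its image, so an element
of the kernel is congruent to `0`. -/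
theorem ker_tableHom_le (hl : l none = 0) :
    RingHom.ker (tableHom κ l) ≤ arrowIdeal k (TwoStep (Option S)) ^ 2 := by
  -- The inverse of the transvection, thanks to `l none = 0`.
  let τ : (Option S →₀ k) →ₗ[k] (Option S →₀ k) := Finsupp.linearCombination k fun s =>
    Finsupp.single s 1 + Finsupp.single none (l s)
  let pr := (linearEquivProd (tableMap k κ)).toLinearMap ∘ₗ (tableHom κ l).toLinearMap
  let lowD : (Fin 3 → k) →ₗ[k] PathAlgebra k (TwoStep (Option S)) :=
    ∑ a : TwoStep (Option S), (LinearMap.proj a.level).smulRight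
      (ofPath k (.nil : Quiver.Path a a))
  let lowL := Finsupp.linearCombination k fun s : Option S => ofPath k (fst s).toPath
  let lowR := Finsupp.linearCombination k fun s : Option S => ofPath k (snd s).toPath
  let low : (Fin 3 → k) × (Option S →₀ k) × (Option S →₀ k) × (C →₀ k) →ₗ[k]
      PathAlgebra k (TwoStep (Option S)) :=
    -- The corner is discarded, since it comes from paths of length two.
    lowD.coprod ((lowL ∘ₗ τ).coprod (lowR.coprod 0))
  have hlow : ∀ f, f - low (pr f) ∈ arrowIdeal k (TwoStep (Option S)) ^ 2 := by
    have : ((arrowIdeal k (TwoStep (Option S)) ^ 2).restrictScalars k).comap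
        (LinearMap.id - low ∘ₗ pr) = ⊤ := by
      refine submodule_eq_top fun a b p => ?_
      rw [Submodule.mem_comap, Submodule.restrictScalars_mem, LinearMap.sub_apply,
        LinearMap.comp_apply, LinearMap.id_apply]
      induction p using path_cases with
      | nil a =>
        have : low (pr (ofPath k (.nil : Quiver.Path a a))) =
            ofPath k (.nil : Quiver.Path a a) := by
          simp only [pr, low, LinearMap.comp_apply, AlgHom.toLinearMap_apply, tableHom_nil,
            LinearEquiv.coe_coe, linearEquivProd_apply, LinearMap.coprod_apply, map_zero, add_zero,
            lowD, LinearMap.sum_apply, LinearMap.smulRight_apply, LinearMap.proj_apply]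
          rw [Finset.sum_eq_single a]
          · simp
          · intro b _ hb
            have h : b.level ≠ a.level := by
              revert a b
              rintro (_ | _ | _) (_ | _ | _) <;> simp [level]
            rw [Pi.single_eq_of_ne h, zero_smul]
          · simp
        rw [this, sub_self]
        exact zero_mem _
      | fst s =>
        have : low (pr (ofPath k (fst s).toPath)) = ofPath k (fst s).toPath := by
          simp [pr, low, lowL, τ, tableHom_fst, hl]
        rw [this, sub_self]
        exact zero_mem _
      | snd s =>
        have : low (pr (ofPath k (snd s).toPath)) = ofPath k (snd s).toPath := by
          simp [pr, low, lowR, tableHom_snd]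
        rw [this, sub_self]
        exact zero_mem _
      | long s t =>
        have : low (pr (ofPath k (long s t))) = 0 := by
          simp [pr, low, tableHom_long]
        rw [this, sub_zero, ofPath_long, Submodule.pow_succ, Submodule.pow_one]
        exact Ideal.mul_mem_mul (ofPath_toPath_mem_arrowIdeal _) (ofPath_toPath_mem_arrowIdeal _)
    intro f
    exact (this.ge trivial : f ∈ _)
  intro f hf
  have h := hlow f
  rw [RingHom.mem_ker] at hf
  have h' : pr f = 0 := by simp [pr, hf]
  rwa [h', map_zero, sub_zero] at h

theorem tableHom_surjective (hκ : ∀ c, ∃ s t, κ s t = c) (hl : l none = 0) :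
    Function.Surjective (tableHom κ l) := by
  let N : Submodule k (BilinearAlgebra (tableMap k κ)) := LinearMap.range (tableHom κ l).toLinearMap
  have hN : ∀ f, tableHom κ l f ∈ N := fun f => ⟨f, rfl⟩
  have hD : ∀ d : Fin 3 → k, (⟨d, 0, 0, 0⟩ : BilinearAlgebra (tableMap k κ)) ∈ N := by
    intro d
    have := N.add_mem (N.add_mem
      (N.smul_mem (d 0) (hN (ofPath k (.nil : Quiver.Path (source : TwoStep (Option S)) _))))
      (N.smul_mem (d 1) (hN (ofPath k (.nil : Quiver.Path (middle : TwoStep (Option S)) _)))))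
      (N.smul_mem (d 2) (hN (ofPath k (.nil : Quiver.Path (target : TwoStep (Option S)) _))))
    convert this using 1
    rw [tableHom_nil, tableHom_nil, tableHom_nil]
    ext1
    · ext j
      fin_cases j <;> simp [level]
    all_goals simp
  have hL : ∀ a, (⟨0, a, 0, 0⟩ : BilinearAlgebra (tableMap k κ)) ∈ N := by
    intro a
    induction a using Finsupp.induction_linear with
    | zero => exact N.zero_mem
    | add a b ha hb =>
      have := N.add_mem ha hb
      convert this using 1
      ext1 <;> simp
    | single s r =>
      -- The arrow `none` is sent to its own basis vector, so adding `l s` times it undoes the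
      -- transvection.
      have := N.smul_mem r (N.add_mem (hN (ofPath k (fst s).toPath))
        (N.smul_mem (l s) (hN (ofPath k (fst none).toPath))))
      convert this using 1
      rw [tableHom_fst, tableHom_fst]
      ext1 <;> simp [hl, smul_sub, -Finsupp.single_mul]
  have hR : ∀ a, (⟨0, 0, a, 0⟩ : BilinearAlgebra (tableMap k κ)) ∈ N := by
    intro a
    induction a using Finsupp.induction_linear with
    | zero => exact N.zero_mem
    | add a b ha hb =>
      have := N.add_mem ha hb
      convert this using 1
      ext1 <;> simp
    | single s r =>
      have := N.smul_mem r (hN (ofPath k (snd s).toPath))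
      convert this using 1
      rw [tableHom_snd]
      ext1 <;> simp
  have hC : ∀ a, (⟨0, 0, 0, a⟩ : BilinearAlgebra (tableMap k κ)) ∈ N := by
    intro a
    induction a using Finsupp.induction_linear with
    | zero => exact N.zero_mem
    | add a b ha hb =>
      have := N.add_mem ha hb
      convert this using 1
      ext1 <;> simp
    | single c r =>
      obtain ⟨s, t, rfl⟩ := hκ c
      have := N.smul_mem r (N.add_mem (hN (ofPath k (long s t)))
        (N.smul_mem (l s) (hN (ofPath k (long none t)))))
      convert this using 1
      rw [tableHom_long, tableHom_long]
      ext1 <;> simp [hl, smul_sub, -Finsupp.single_mul]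
  intro x
  have := N.add_mem (N.add_mem (hD x.diag) (hL x.left)) (N.add_mem (hR x.right) (hC x.corner))
  obtain ⟨f, hf⟩ := this
  refine ⟨f, hf.trans ?_⟩
  ext1 <;> simp

theorem isPresentation_tableHom (hκ : ∀ c, ∃ s t, κ s t = c) (hl : l none = 0) :
    IsPresentation (tableHom κ l) where
  surjective := tableHom_surjective κ hκ hl
  admissible := ⟨inferInstance, ⟨3, by norm_num, arrowIdeal_pow_three_le κ l⟩,
    ker_tableHom_le κ hl⟩

/-- The label `none` provides an arrow in each step even if `S` is empty, which keeps the quiver and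
the algebra connected. The zero coefficients give the canonical presentation. -/
theorem isTriangularAlgebra [Finite S] [Finite C] (hκ : ∀ c, ∃ s t, κ s t = c) :
    IsTriangularAlgebra k (BilinearAlgebra (tableMap k κ)) (TwoStep (Option S)) where
  finiteDimensional := inferInstance
  basic := isBasicAlgebra
  connected := isConnectedAlgebra
  quiver := isFiniteConnectedQuiver none
  acyclic := isAcyclicQuiver
  exists_presentation := ⟨tableHom κ 0, isPresentation_tableHom κ hκ rfl⟩

end TwoStep

/-! ### Transport of walks to a base point -/

section BasedClass

variable {k : Type u} {V : Type v} [Field k] [Quiver.{w} V] [Fintype V]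
  {I : Ideal (PathAlgebra k V)} {x : V}

/-- The class in the fundamental group at `x` of a walk, closed up by means of chosen walks from `x`
to all vertices. -/
def basedClass (I : Ideal (PathAlgebra k V))
    (T : ∀ y : Quiver.Symmetrify V, QuiverWalk (Quiver.symVertex x) y) {y z : Quiver.Symmetrify V}
    (w : QuiverWalk y z) : QuiverFundamentalGroup I x :=
  Quotient.mk _ (((T y).comp w).comp (T z).reverse)

variable (T : ∀ y : Quiver.Symmetrify V, QuiverWalk (Quiver.symVertex x) y)

theorem basedClass_congr {y z : Quiver.Symmetrify V} {w w' : QuiverWalk y z}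
    (h : WalkHomotopic I w w') : basedClass I T w = basedClass I T w' :=
  Quotient.sound (WalkHomotopic.comp _ _ h)

/-- The inserted detour `(T z)⁻¹ T z` contracts. -/
theorem basedClass_comp {y z t : Quiver.Symmetrify V} (w : QuiverWalk y z) (w' : QuiverWalk z t) :
    basedClass I T (w.comp w') = basedClass I T w * basedClass I T w' := by
  refine (Quotient.sound ?_ : _ = Quotient.mk _ ((((T y).comp w).comp (T z).reverse).comp
    (((T z).comp w').comp (T t).reverse)))
  have h := WalkHomotopic.comp ((T y).comp w) (w'.comp (T t).reverse)
    (WalkHomotopic.reverse_comp (I := I) (T z))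
  simp only [Quiver.Path.comp_nil, Quiver.Path.comp_assoc] at h ⊢
  exact h.symm

theorem basedClass_eq_one {y z : Quiver.Symmetrify V} {w : QuiverWalk y z}
    (h : (T y).comp w = T z) : basedClass I T w = 1 := by
  refine Quotient.sound ?_
  rw [h]
  exact WalkHomotopic.comp_reverse _

theorem basedClass_nil (y : Quiver.Symmetrify V) :
    basedClass I T (.nil : QuiverWalk y y) = 1 :=
  basedClass_eq_one T rfl

theorem basedClass_cons {y z t : Quiver.Symmetrify V} (w : QuiverWalk y z) (e : z ⟶ t) :
    basedClass I T (w.cons e) = basedClass I T w * basedClass I T e.toPath :=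
  basedClass_comp T w e.toPath

theorem basedClass_toNeg {a b : V} (α : a ⟶ b) :
    basedClass I T (Quiver.Hom.toPath (V := Quiver.Symmetrify V) α.toNeg) =
      (basedClass I T α.toPath.toWalk)⁻¹ :=
  eq_inv_iff_mul_eq_one.2 <|
    ((basedClass_comp T (Quiver.Hom.toPath (V := Quiver.Symmetrify V) α.toNeg) _).symm.trans
      (basedClass_congr T (WalkHomotopic.inv_arrow α))).trans (basedClass_nil T _)

theorem basedClass_closed (hT : WalkHomotopic I (T (Quiver.symVertex x)) .nil)
    (w : QuiverWalk (Quiver.symVertex x) (Quiver.symVertex x)) :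
    basedClass I T w = Quotient.mk _ w := by
  refine Quotient.sound ?_
  have h := WalkHomotopic.comp_congr (hT.comp_right w) hT.reverse_congr
  rw [Quiver.Path.nil_comp] at h
  exact h

end BasedClass

theorem walkDegree_reverse {V : Type v} [Quiver.{w} V] {H : Type*} [Group H]
    (d : ∀ {a b : V}, (a ⟶ b) → H) {x y : Quiver.Symmetrify V} (p : QuiverWalk x y) :
    walkDegree @d p.reverse = (walkDegree @d p)⁻¹ := by
  induction p with
  | nil => simp [Quiver.Path.reverse]
  | cons p e ih =>
    have h : stepDegree @d (Quiver.reverse e) = (stepDegree @d e)⁻¹ := by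
      rcases e with α | α
      · rfl
      · exact (inv_inv (d α)).symm
    have h' : walkDegree @d (Quiver.reverse e).toPath = stepDegree @d (Quiver.reverse e) :=
      one_mul _
    rw [Quiver.Path.reverse, walkDegree_comp, walkDegree_cons, ih, h', h, mul_inv_rev]

namespace TwoStep

open PathAlgebra BilinearAlgebra

variable {O S C : Type} {k : Type u} [Field k]

/-! ### The grading -/

open Classical in
/-- The projection to the span of the basis vectors of degree `h`. -/
def degreeProj (k : Type u) [Field k] {D : Type*} (γ : O → D) (h : D) : (O →₀ k) →ₗ[k] (O →₀ k) :=
  Finsupp.linearCombination k fun s => if γ s = h then Finsupp.single s 1 else 0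

theorem degreeProj_single {D : Type*} {γ : O → D} {h : D} {s : O} (hs : γ s = h) (r : k) :
    degreeProj k γ h (Finsupp.single s r) = Finsupp.single s r := by
  simp [degreeProj, hs]

theorem degreeProj_single_of_ne {D : Type*} {γ : O → D} {h : D} {s : O} (hs : γ s ≠ h) (r : k) :
    degreeProj k γ h (Finsupp.single s r) = 0 := by
  simp [degreeProj, hs]

variable {H : Type v} [Group H]

/-- The degree of an arrow is the degree of its label. -/
def arrowDegree (γ : O → H) : ∀ {a b : TwoStep O}, (a ⟶ b) → H
  | _, _, .fst s => γ s
  | _, _, .snd s => γ s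

theorem walkDegree_fst (γ : O → H) (s : O) :
    walkDegree (arrowDegree γ) (fst s).toPath.toWalk = γ s :=
  one_mul _

theorem walkDegree_snd (γ : O → H) (s : O) :
    walkDegree (arrowDegree γ) (snd s).toPath.toWalk = γ s :=
  one_mul _

theorem walkDegree_long (γ : O → H) (s t : O) :
    walkDegree (arrowDegree γ) (long s t).toWalk = γ s * γ t :=
  congrArg (· * γ t) (one_mul (γ s))

open Classical in
/-- The projection of the algebra to its component of degree `h`. -/
def gradeProj (κ : O → O → C) (γ : O → H) (δ : C → H) (h : H) :
    BilinearAlgebra (tableMap k κ) →ₗ[k] BilinearAlgebra (tableMap k κ) :=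
  (linearEquivProd (tableMap k κ)).symm.toLinearMap ∘ₗ
    ((if h = 1 then LinearMap.id else 0 : (Fin 3 → k) →ₗ[k] (Fin 3 → k)).prodMap
      ((degreeProj k γ h).prodMap ((degreeProj k γ h).prodMap (degreeProj k δ h)))) ∘ₗ
    (linearEquivProd (tableMap k κ)).toLinearMap

open Classical in
theorem gradeProj_mk (κ : O → O → C) (γ : O → H) (δ : C → H) (h : H) (d : Fin 3 → k)
    (a b : O →₀ k) (c : C →₀ k) :
    gradeProj κ γ δ h ⟨d, a, b, c⟩ =
      ⟨if h = 1 then d else 0, degreeProj k γ h a, degreeProj k γ h b, degreeProj k δ h c⟩ := by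
  by_cases h₁ : h = 1
  · simp only [gradeProj, h₁, if_true]; rfl
  · simp only [gradeProj, h₁, if_false]; rfl

variable {κ : Option S → Option S → C} {l : Option S → k} {γ : Option S → H} {δ : C → H}

/-- The transvection mixes `s` with `none` only when both have degree `1`. -/
theorem degreeProj_fst (hγ : γ none = 1) (hl : ∀ s, l s ≠ 0 → γ s = 1) (s : Option S) :
    degreeProj k γ (γ s) (Finsupp.single s 1 - Finsupp.single none (l s)) =
      Finsupp.single s 1 - Finsupp.single none (l s) := by
  rw [map_sub, degreeProj_single rfl]
  by_cases h : l s = 0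
  · simp [h]
  · rw [degreeProj_single (hγ.trans (hl s h).symm)]

theorem degreeProj_fst_of_ne (hγ : γ none = 1) (hl : ∀ s, l s ≠ 0 → γ s = 1) {s : Option S} {h : H}
    (hs : γ s ≠ h) :
    degreeProj k γ h (Finsupp.single s 1 - Finsupp.single none (l s)) = 0 := by
  rw [map_sub, degreeProj_single_of_ne hs]
  by_cases h : l s = 0
  · simp [h]
  · rw [degreeProj_single_of_ne (by rwa [hγ, ← hl s h]), sub_zero]

theorem degreeProj_long (hδ : ∀ s t, δ (κ s t) = γ s * γ t) (hγ : γ none = 1)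
    (hl : ∀ s, l s ≠ 0 → γ s = 1) (s t : Option S) :
    degreeProj k δ (γ s * γ t)
        (Finsupp.single (κ s t) 1 - Finsupp.single (κ none t) (l s)) =
      Finsupp.single (κ s t) 1 - Finsupp.single (κ none t) (l s) := by
  rw [map_sub, degreeProj_single (hδ s t)]
  by_cases h : l s = 0
  · simp [h]
  · rw [degreeProj_single (by rw [hδ, hγ, hl s h])]

theorem degreeProj_long_of_ne (hδ : ∀ s t, δ (κ s t) = γ s * γ t) (hγ : γ none = 1)
    (hl : ∀ s, l s ≠ 0 → γ s = 1) {s t : Option S} {h : H} (hs : γ s * γ t ≠ h) :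
    degreeProj k δ h (Finsupp.single (κ s t) 1 - Finsupp.single (κ none t) (l s)) = 0 := by
  rw [map_sub, degreeProj_single_of_ne (by rwa [hδ])]
  by_cases h : l s = 0
  · simp [h]
  · rw [degreeProj_single_of_ne (by rwa [hδ, hγ, ← hl s h]), sub_zero]

/-- Each path is sent to a homogeneous element of the same degree, so minimal relations of the
kernel are homogeneous. -/
theorem walkDegree_eq_of_walkHomotopic (hδ : ∀ s t, δ (κ s t) = γ s * γ t) (hγ : γ none = 1)
    (hl : ∀ s, l s ≠ 0 → γ s = 1) {x y : Quiver.Symmetrify (TwoStep (Option S))}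
    {p q : QuiverWalk x y} (h : WalkHomotopic (RingHom.ker (tableHom κ l)) p q) :
    walkDegree (arrowDegree γ) p = walkDegree (arrowDegree γ) q := by
  refine h.walkDegree_eq _ fun c hc p hp q hq =>
    hc.walkDegree_eq _ (gradeProj κ γ δ) (fun p => ?_) (fun p h hne => ?_) hp hq
  · induction p using path_cases with
    | nil a =>
      rw [tableHom_nil, gradeProj_mk]
      have : walkDegree (arrowDegree γ) (.nil : Quiver.Path a a).toWalk = 1 := rfl
      simp [this]
    | fst s =>
      rw [tableHom_fst, gradeProj_mk, walkDegree_fst, degreeProj_fst hγ hl]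
      simp
    | snd s =>
      rw [tableHom_snd, gradeProj_mk, walkDegree_snd, degreeProj_single rfl]
      simp
    | long s t =>
      rw [tableHom_long, gradeProj_mk, walkDegree_long, degreeProj_long hδ hγ hl]
      simp
  · induction p using path_cases with
    | nil a =>
      have : h ≠ 1 := fun h₁ => hne h₁.symm
      rw [tableHom_nil, gradeProj_mk]
      ext1 <;> simp [this]
    | fst s =>
      rw [walkDegree_fst] at hne
      rw [tableHom_fst, gradeProj_mk, degreeProj_fst_of_ne hγ hl hne]
      ext1 <;> simp
    | snd s =>
      rw [walkDegree_snd] at hne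
      rw [tableHom_snd, gradeProj_mk, degreeProj_single_of_ne hne]
      ext1 <;> simp
    | long s t =>
      rw [walkDegree_long] at hne
      rw [tableHom_long, gradeProj_mk, degreeProj_long_of_ne hδ hγ hl hne]
      ext1 <;> simp

/-! ### The fundamental group -/

/-- The coefficients of the image in the corner add up to `1 - l s`, whatever identifications `κ`
makes. -/
theorem ofPath_notMem_ker (hl : ∀ s, l s ≠ 1)
    (p : Quiver.Path (source : TwoStep (Option S)) target) :
    ofPath k p ∉ RingHom.ker (tableHom κ l) := by
  obtain ⟨s, t, rfl⟩ := exists_eq_long p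
  intro h
  rw [RingHom.mem_ker, tableHom_long] at h
  have h' := congrArg (Finsupp.linearCombination k fun _ : C => (1 : k)) (congrArg corner h)
  simp only [map_sub, Finsupp.linearCombination_single, corner_zero, map_zero, smul_eq_mul,
    mul_one] at h'
  exact hl s (sub_eq_zero.1 h').symm

/-- The product of two labels is that of a third label with `none`. -/
theorem walkHomotopic_mul (hl : ∀ s, l s ≠ 1) {x y z : S}
    (hx : l (some x) = 0) (hz : l (some z) = 0)
    (hκ : κ (some x) (some y) = κ (some z) none) :
    WalkHomotopic (RingHom.ker (tableHom κ l)) (long (some x) (some y)).toWalk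
      (long (some z) none).toWalk := by
  refine (WalkHomotopic.of_three_term (ofPath_notMem_ker hl) (r := long none none)
    (fun h => by simpa using long_injective h) (fun h => by simpa using long_injective h)
    (fun h => by simpa using long_injective h) 0 ?_).1
  rw [RingHom.mem_ker]
  simp only [map_sub, tableHom_long, hx, hz, hκ, zero_smul, add_zero]
  rw [sub_eq_zero]
  simp

/-- The image of `long (some s) none` falls short of that of `long none (some s)` by `l (some s)`
times the image of `long none none`. A nonzero coefficient therefore brings this third path into the
minimal relation. -/
theorem walkHomotopic_swap (hl : ∀ s, l s ≠ 1) (hl₀ : l none = 0) (s : S)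
    (hκ : κ (some s) none = κ none (some s)) :
    WalkHomotopic (RingHom.ker (tableHom κ l)) (long (some s) none).toWalk
        (long none (some s)).toWalk ∧
      (l (some s) ≠ 0 → WalkHomotopic (RingHom.ker (tableHom κ l)) (long (some s) none).toWalk
        (long none none).toWalk) := by
  refine WalkHomotopic.of_three_term (ofPath_notMem_ker hl)
    (fun h => by simpa using long_injective h) (fun h => by simpa using long_injective h)
    (fun h => by simpa using long_injective h) _ ?_
  rw [RingHom.mem_ker]
  simp only [map_sub, map_add, map_smul, tableHom_long, hκ, hl₀]
  rw [sub_eq_zero]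
  ext1 <;> simp

/-- The label `none` is the unit, the labels in the range of `ι` are the generators of a
presentation of `H`, and all other labels are made trivial by the transvection. -/
theorem nonempty_fundamentalGroup_mulEquiv {T : Type} {g : T → H} {R : T → T → T → Prop}
    (hg : IsTrianglePresentation g R) (ι : T → S)
    (hδ : ∀ s t, δ (κ s t) = γ s * γ t) (hγ : γ none = 1) (hγι : ∀ t, γ (some (ι t)) = g t)
    (hl : ∀ s, l s ≠ 1) (hl₀ : l none = 0) (hlι : ∀ t, l (some (ι t)) = 0)
    (hι : ∀ s, s ∉ Set.range ι → γ (some s) = 1 ∧ l (some s) ≠ 0)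
    (hκ : ∀ s, κ (some s) none = κ none (some s))
    (hκR : ∀ x y z, R x y z → κ (some (ι x)) (some (ι y)) = κ (some (ι z)) none)
    (x : TwoStep (Option S)) :
    Nonempty (QuiverFundamentalGroup (RingHom.ker (tableHom κ l)) x ≃* H) := by
  have hlγ : ∀ s, l s ≠ 0 → γ s = 1 := by
    rintro (_ | s) hs
    · exact hγ
    · refine (hι s ?_).1
      rintro ⟨t, rfl⟩
      exact hs (hlι t)
  set I := RingHom.ker (tableHom κ l)
  -- Transport runs along the maximal tree of the arrows labelled `none`, whose classes thereby
  -- become trivial.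
  let W : ∀ y : Quiver.Symmetrify (TwoStep (Option S)), QuiverWalk (Quiver.symVertex x) y :=
    fun y => (treeWalk none x).reverse.comp (treeWalk none y)
  let A : Option S → QuiverFundamentalGroup I x := fun s => basedClass I W (fst s).toPath.toWalk
  let B : Option S → QuiverFundamentalGroup I x := fun s => basedClass I W (snd s).toPath.toWalk
  have hlong : ∀ s t, basedClass I W (long s t).toWalk = A s * B t := fun s t =>
    basedClass_comp W (fst s).toPath.toWalk (snd t).toPath.toWalk
  have hA : A none = 1 := basedClass_eq_one W rfl
  have hB : B none = 1 := basedClass_eq_one W rfl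
  have hAB : ∀ s, A s = B s := by
    rintro (_ | s)
    · rw [hA, hB]
    · have := basedClass_congr W (walkHomotopic_swap hl hl₀ s (hκ s)).1
      rwa [hlong, hlong, hA, hB, mul_one, one_mul] at this
  have hA₁ : ∀ s, l (some s) ≠ 0 → A (some s) = 1 := fun s hs => by
    have := basedClass_congr W ((walkHomotopic_swap hl hl₀ s (hκ s)).2 hs)
    rwa [hlong, hlong, hA, hB, mul_one, one_mul] at this
  -- The relators hold for the classes of the arrows: `x y = z` is read off from `long x y` and
  -- `long z none`.
  obtain ⟨F, hF⟩ := hg.exists_hom (QuiverFundamentalGroup I x) (fun t => A (some (ι t)))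
    fun a b c hR => by
      have := basedClass_congr W (walkHomotopic_mul hl (hlι a) (hlι c) (hκR a b c hR))
      rwa [hlong, hlong, hB, mul_one, ← hAB] at this
  have hFγ : ∀ s, F (γ s) = A s := by
    rintro (_ | s)
    · rw [hγ, map_one, hA]
    · by_cases hs : s ∈ Set.range ι
      · obtain ⟨t, rfl⟩ := hs
        rw [hγι, hF]
      · rw [(hι s hs).1, map_one, hA₁ s (hι s hs).2]
  have hFarrow : ∀ {a b : TwoStep (Option S)} (α : a ⟶ b),
      F (arrowDegree γ α) = basedClass I W α.toPath.toWalk := by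
    rintro _ _ (s | s)
    · exact hFγ s
    · exact (hFγ s).trans (hAB s)
  -- The class of a walk depends only on its degree. This gives `F ∘ D = id`, that is, injectivity
  -- of the degree map `D`.
  have hFwalk : ∀ {y z : Quiver.Symmetrify (TwoStep (Option S))} (p : QuiverWalk y z),
      F (walkDegree (arrowDegree γ) p) = basedClass I W p := by
    intro y z p
    induction p with
    | nil => rw [walkDegree_nil, map_one, basedClass_nil]
    | cons p e ih =>
      rw [walkDegree_cons, map_mul, ih, basedClass_cons]
      congr 1
      rcases e with α | α
      · exact hFarrow α
      · exact (map_inv F _).trans ((congrArg _ (hFarrow α)).trans (basedClass_toNeg W α).symm)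
  let D : QuiverFundamentalGroup I x →* H := MonoidHom.mk'
    (Quotient.lift (fun p => walkDegree (arrowDegree γ) p)
      fun _ _ h => walkDegree_eq_of_walkHomotopic hδ hγ hlγ h)
    (by
      rintro ⟨p⟩ ⟨q⟩
      exact walkDegree_comp _ p q)
  have htree : ∀ y, walkDegree (arrowDegree γ) (treeWalk (none : Option S) y) = 1 := by
    rintro (_ | _ | _)
    · rfl
    · exact (walkDegree_fst γ none).trans hγ
    · exact (walkDegree_long γ none none).trans (by rw [hγ, mul_one])
  -- Closing up a walk by `W` leaves its degree unchanged; hence `D ∘ F` fixes the generators.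
  have hW : ∀ y, walkDegree (arrowDegree γ) (W y) = 1 := fun y => by
    refine (walkDegree_comp _ _ _).trans ?_
    refine (congrArg₂ _ ((walkDegree_reverse _ _).trans (congrArg _ (htree x))) (htree y)).trans ?_
    simp
  refine ⟨MonoidHom.toMulEquiv D F ?_ ?_⟩
  · ext p
    obtain ⟨p, rfl⟩ := Quotient.exists_rep p
    exact (hFwalk p).trans (basedClass_closed W (WalkHomotopic.reverse_comp _) p)
  · refine MonoidHom.eq_of_eqOn_dense hg.closure_eq_top ?_
    rintro _ ⟨t, rfl⟩
    rw [MonoidHom.comp_apply, hF, MonoidHom.id_apply]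
    change walkDegree (arrowDegree γ) (((W _).comp _).comp (W _).reverse) = g t
    rw [walkDegree_comp, walkDegree_comp, walkDegree_reverse, hW, hW, walkDegree_fst, hγι]
    simp

end TwoStep

/-! ### The multiplication table of a family of presentations -/

/-- The identifications of pairs of labels that are forced by the presentations with relators `R`;
the label `none` stands for the unit. -/
inductive TableRel {ι : Type} {S : ι → Type} (R : ∀ i, S i → S i → S i → Prop) :
    Option (Σ i, S i) × Option (Σ i, S i) → Option (Σ i, S i) × Option (Σ i, S i) → Prop
  | swap (s : Σ i, S i) : TableRel R (some s, none) (none, some s)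
  | mul (i : ι) (x y z : S i) (h : R i x y z) :
      TableRel R (some ⟨i, x⟩, some ⟨i, y⟩) (some ⟨i, z⟩, none)

open Classical in
/-- The value of a label in the group with index `i`. -/
def labelValue {ι : Type} {S : ι → Type} {G : ι → Type v} [∀ i, Group (G i)]
    (g : ∀ i, S i → G i) (i : ι) : Option (Σ i, S i) → G i
  | none => 1
  | some s => if h : s.1 = i then g i (h ▸ s.2) else 1

/-- Relators of the group `i` hold by assumption, and those of any other group read `1 * 1 = 1 * 1`.
Hence the degree in `G i` descends to the identified pairs. -/
theorem TableRel.labelValue_mul_eq {ι : Type} {S : ι → Type} {G : ι → Type v} [∀ i, Group (G i)]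
    {g : ∀ i, S i → G i} {R : ∀ i, S i → S i → S i → Prop}
    (hg : ∀ i, IsTrianglePresentation (g i) (R i)) (i : ι)
    {p q : Option (Σ i, S i) × Option (Σ i, S i)} (h : TableRel R p q) :
    labelValue g i p.1 * labelValue g i p.2 = labelValue g i q.1 * labelValue g i q.2 := by
  cases h with
  | swap s => simp [labelValue]
  | mul j x y z h =>
    by_cases hj : j = i
    · subst hj
      simp [labelValue, (hg j).mul_eq x y z h]
    · simp [labelValue, hj]

end

/-! ### The common algebra and its `n` presentations. -/

theorem theoremB (k : Type u) [Field k] [IsAlgClosed k] (n : ℕ) (G : Fin n → Type v)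
    [∀ i, Group (G i)] (hG : ∀ i, CyclicProductClass (G i)) :
    ∃ (V : Type) (_ : Fintype V) (_ : Quiver.{0} V) (A : Type u) (_ : Ring A) (_ : Algebra k A)
      (ν : Fin n → (PathAlgebra k V →ₐ[k] A)),
      IsTriangularAlgebra k A V ∧
      ∀ i, IsPresentation (ν i) ∧
        ∀ x : V, Nonempty (QuiverFundamentalGroup (RingHom.ker (ν i)) x ≃* G i) := by
  classical
  choose S hS g R hg using fun i => (hG i).hasTrianglePresentation
  have : Infinite k := IsAlgClosed.instInfinite
  -- `c ≠ 0` makes the foreign labels trivial; `c ≠ 1` keeps paths of length two out of the kernel.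
  obtain ⟨c, hc⟩ := Infinite.exists_notMem_finset ({0, 1} : Finset k)
  simp only [Finset.mem_insert, Finset.mem_singleton, not_or] at hc
  let κ : Option (Σ i, S i) → Option (Σ i, S i) → Quot (TableRel R) := fun s t =>
    Quot.mk _ (s, t)
  have hκ : ∀ q, ∃ s t, κ s t = q := by
    rintro ⟨s, t⟩
    exact ⟨s, t, rfl⟩
  -- Only the transvection depends on `i`: it moves exactly the labels of the other groups.
  let l : Fin n → Option (Σ i, S i) → k := fun i s =>
    s.elim 0 fun s => if s.1 = i then 0 else c
  refine ⟨TwoStep (Option (Σ i, S i)), inferInstance, inferInstance,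
    BilinearAlgebra (TwoStep.tableMap k κ), inferInstance, inferInstance,
    fun i => TwoStep.tableHom κ (l i), TwoStep.isTriangularAlgebra κ hκ, fun i =>
    ⟨TwoStep.isPresentation_tableHom κ hκ rfl, fun x => ?_⟩⟩
  refine TwoStep.nonempty_fundamentalGroup_mulEquiv (hg i) (γ := labelValue g i)
    (δ := Quot.lift (fun p => labelValue g i p.1 * labelValue g i p.2)
      fun _ _ h => h.labelValue_mul_eq hg i)
    (fun t => ⟨i, t⟩) (fun _ _ => rfl) rfl (fun t => by simp [labelValue]) ?_ rfl
    (fun t => by simp [l]) ?_ (fun s => Quot.sound (.swap s))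
    (fun a b d h => Quot.sound (.mul i a b d h)) x
  · rintro (_ | s)
    · exact zero_ne_one
    · simp only [l, Option.elim]
      split_ifs
      · exact zero_ne_one
      · exact hc.2
  · rintro ⟨j, s⟩ hs
    have hj : j ≠ i := by
      rintro rfl
      exact hs ⟨s, rfl⟩
    simp [labelValue, l, hj, hc.1]
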